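/- Throughout, a groupoid is a second countable locally compact Hausdorff groupoid, with range and source maps $r,s$; a left action of a groupoid $K$ on a space $T$ has a moment map $\rho_K:T\to K^{(0)}$, and $k\cdot t$ is defined when $s(k)=\rho_K(t)$. Fell bundles are upper semicontinuous and saturated: each fibre $B(k)$ is a $B(r(k))$–$B(s(k))$ imprimitivity bimodule. Let $G$ be a groupoid with a Haar system and let $p:\mathcal B\to G$ be a Fell bundle. Let $G$ act on the space $T=G$ in two commuting ways: by left translation (first action, moment map $r$), and by $x\cdot y=yx^{-1}$ for $s(x)=s(y)$ (second action, moment map $s$). Let $G\ltimes G=\{(k,t)\in G\times G: s(k)=r(t)\}$ be the action groupoid of the first action, with $r(k,t)=kt$, $s(k,t)=t$ (where $t$ is identified with the unit $(r(t),t)$) and $(k,\ell t)(\ell,t)=(k\ell,t)$. Let $\mathcal B\ltimes G=\{(b,t): s(p(b))=r(t)\}$ be the action Fell bundle over $G\ltimes G$, with $(b,t)$ lying over $(p(b),t)$, $(b,p(c)t)(c,t)=(bc,t)$ and $(b,t)^*=(b^*,p(b)t)$. Then $G\ltimes G$ is again such a groupoid, $\mathcal B\ltimes G$ is a Fell bundle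 over it, and the second action induces an action of $G$ on the Fell bundle $\mathcal B\ltimes G$ by isomorphisms, $x\cdot(b,t)=(b,tx^{-1})$ for $s(x)=s(t)$, covering $x\cdot(k,t)=(k,tx^{-1})$. Let $(\mathcal B\ltimes G)\rtimes G=\{(b,t,x): (b,t)\in\mathcal B\ltimes G,\ s(t)=r(x)\}$ be the resulting semidirect product Fell bundle over $(G\ltimes G)\rtimes G$; in a semidirect product, $(a,x)(a',y)=(a(x\cdot a'),xy)$ and $(a,x)^*=(x^{-1}\cdot a^*,x^{-1})$. **Theorem.** The Banach bundle $\mathcal B\ltimes G\to G\ltimes G$ is a $((\mathcal B\ltimes G)\rtimes G)$–$\mathcal B$ equivalence of Fell bundles (in the sense of Muhly and Williams; in particular $G\ltimes G$ is a $((G\ltimes G)\rtimes G)$–$G$ equivalence of groupoids), with the operations 1. $(b,t,x)\cdot(c,u)=(bc,\,ux^{-1})$ if $s(x)=s(u)$ and $t=p(c)ux^{-1}$; 2. ${}_*\langle (b,t),(c,u)\rangle=(bc^*,\,p(c)ux^{-1},\,x)$ if $s(p(b))=s(p(c))$, where $x=t^{-1}u$ is the unique element of $G$ with $t=ux^{-1}$;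 3. $(b,t)\cdot c=(bc,\,p(c)^{-1}t)$ if $s(p(b))=r(p(c))$; 4. $\langle (b,t),(c,u)\rangle_*=b^*c$ if $p(b)t=p(c)u$. -/

import Mathlib

open Topology Filter MeasureTheory

/-! ### Groupoids -/

/-- A groupoid given by its set of arrows `G`; the units are the arrows `u` with `r u = u`.
The product `x y` is defined exactly when `s x = r y`. -/
structure Gpd (G : Type*) where
  r : G → G
  s : G → G
  inv : G → G
  mul : (x y : G) → s x = r y → G
  s_r : ∀ x, s (r x) = r x
  r_s : ∀ x, r (s x) = s x
  r_mul : ∀ x y h, r (mul x y h) = r x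
  s_mul : ∀ x y h, s (mul x y h) = s y
  mul_assoc : ∀ x y z (h₁ : s x = r y) (h₂ : s y = r z),
    mul (mul x y h₁) z ((s_mul x y h₁).trans h₂) = mul x (mul y z h₂) (h₁.trans (r_mul y z h₂).symm)
  r_unit_mul : ∀ x, mul (r x) x (s_r x) = x
  mul_s_unit : ∀ x, mul x (s x) (r_s x).symm = x
  r_inv : ∀ x, r (inv x) = s x
  s_inv : ∀ x, s (inv x) = r x
  mul_inv : ∀ x, mul x (inv x) (r_inv x).symm = r x
  inv_mul : ∀ x, mul (inv x) x (s_inv x) = s x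

namespace Gpd

variable {G : Type*} (𝒢 : Gpd G)

/-- The unit space. -/
abbrev Units : Type _ := {u : G // 𝒢.r u = u}

theorem r_r (x : G) : 𝒢.r (𝒢.r x) = 𝒢.r x := by
  have h := 𝒢.r_s (𝒢.r x)
  rwa [𝒢.s_r] at h

theorem s_s (x : G) : 𝒢.s (𝒢.s x) = 𝒢.s x := by
  have h := 𝒢.s_r (𝒢.s x)
  rwa [𝒢.r_s] at h

theorem s_unit {u : G} (h : 𝒢.r u = u) : 𝒢.s u = u := by
  rw [← h, 𝒢.s_r]

theorem mul_congr {x x' y y' : G} (hx : x = x') (hy : y = y') (h : 𝒢.s x = 𝒢.r y)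
    (h' : 𝒢.s x' = 𝒢.r y') : 𝒢.mul x y h = 𝒢.mul x' y' h' := by
  subst hx; subst hy; rfl

theorem unit_mul {u x : G} (hu : 𝒢.r u = u) (h : 𝒢.s u = 𝒢.r x) : 𝒢.mul u x h = x := by
  have e : u = 𝒢.r x := by rw [← h, 𝒢.s_unit hu]
  rw [𝒢.mul_congr e rfl h (𝒢.s_r x), 𝒢.r_unit_mul]

theorem mul_unit {u x : G} (hu : 𝒢.r u = u) (h : 𝒢.s x = 𝒢.r u) : 𝒢.mul x u h = x := by
  have e : u = 𝒢.s x := by rw [h, hu]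
  rw [𝒢.mul_congr rfl e h (𝒢.r_s x).symm, 𝒢.mul_s_unit]

theorem inv_mul_cancel {x y : G} (h : 𝒢.s x = 𝒢.r y) :
    𝒢.mul (𝒢.inv x) (𝒢.mul x y h) ((𝒢.s_inv x).trans (𝒢.r_mul x y h).symm) = y := by
  rw [← 𝒢.mul_assoc (𝒢.inv x) x y (𝒢.s_inv x) h,
    𝒢.mul_congr ((𝒢.inv_mul x).trans h) rfl _ (𝒢.s_r y), 𝒢.r_unit_mul]

theorem mul_inv_cancel {x y : G} (h : 𝒢.s (𝒢.inv x) = 𝒢.r y) :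
    𝒢.mul x (𝒢.mul (𝒢.inv x) y h) ((𝒢.r_inv x).symm.trans (𝒢.r_mul _ y h).symm) = y := by
  rw [← 𝒢.mul_assoc x (𝒢.inv x) y (𝒢.r_inv x).symm h,
    𝒢.mul_congr ((𝒢.mul_inv x).trans ((𝒢.s_inv x).symm.trans h)) rfl _ (𝒢.s_r y), 𝒢.r_unit_mul]

theorem mul_left_cancel {x y z : G} (h : 𝒢.s x = 𝒢.r y) (h' : 𝒢.s x = 𝒢.r z)
    (e : 𝒢.mul x y h = 𝒢.mul x z h') : y = z := by
  rw [← 𝒢.inv_mul_cancel h, ← 𝒢.inv_mul_cancel h']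
  exact 𝒢.mul_congr rfl e _ _

theorem inv_inv (x : G) : 𝒢.inv (𝒢.inv x) = x := by
  have h₁ : 𝒢.s (𝒢.inv x) = 𝒢.r (𝒢.inv (𝒢.inv x)) := (𝒢.r_inv _).symm
  refine 𝒢.mul_left_cancel h₁ (𝒢.s_inv x) ?_
  rw [𝒢.mul_inv, 𝒢.inv_mul, 𝒢.r_inv]

theorem inv_eq_of_mul {x y : G} (h : 𝒢.s x = 𝒢.r y) (e : 𝒢.mul x y h = 𝒢.r x) : 𝒢.inv x = y := by
  refine 𝒢.mul_left_cancel (𝒢.r_inv x).symm h ?_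
  rw [𝒢.mul_inv, e]

theorem inv_of_mul {x y : G} (h : 𝒢.s x = 𝒢.r y) :
    𝒢.inv (𝒢.mul x y h) =
      𝒢.mul (𝒢.inv y) (𝒢.inv x) ((𝒢.s_inv y).trans (h.symm.trans (𝒢.r_inv x).symm)) := by
  have h₁ : 𝒢.s y = 𝒢.r (𝒢.inv y) := (𝒢.r_inv y).symm
  have h₂ : 𝒢.s (𝒢.inv y) = 𝒢.r (𝒢.inv x) := (𝒢.s_inv y).trans (h.symm.trans (𝒢.r_inv x).symm)
  apply 𝒢.inv_eq_of_mul ((𝒢.s_mul x y h).trans (h₁.trans (𝒢.r_mul _ _ h₂).symm))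
  have e : 𝒢.mul y (𝒢.mul (𝒢.inv y) (𝒢.inv x) h₂) (h₁.trans (𝒢.r_mul _ _ h₂).symm) = 𝒢.inv x :=
    𝒢.mul_inv_cancel h₂
  rw [𝒢.mul_assoc x y _ h (h₁.trans (𝒢.r_mul _ _ h₂).symm),
    𝒢.mul_congr rfl e _ (𝒢.r_inv x).symm, 𝒢.mul_inv, 𝒢.r_mul]

theorem inv_unit {u : G} (hu : 𝒢.r u = u) : 𝒢.inv u = u := by
  have h : 𝒢.s u = 𝒢.r u := (𝒢.s_unit hu).trans hu.symm
  exact 𝒢.inv_eq_of_mul h ((𝒢.unit_mul hu h).trans hu.symm)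

/-- A second countable locally compact Hausdorff groupoid. -/
structure IsLocallyCompact [TopologicalSpace G] : Prop where
  t2 : T2Space G
  locallyCompact : LocallyCompactSpace G
  secondCountable : SecondCountableTopology G
  continuous_r : Continuous 𝒢.r
  continuous_s : Continuous 𝒢.s
  continuous_inv : Continuous 𝒢.inv
  continuous_mul : Continuous fun z : {z : G × G // 𝒢.s z.1 = 𝒢.r z.2} => 𝒢.mul z.1.1 z.1.2 z.2

open Classical in
/-- A (left) Haar system: Radon measures `μ u` with support `r⁻¹(u)`, indexed by the units,
varying continuously on compactly supported continuous functions, and left invariant. -/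
structure HaarSystem [TopologicalSpace G] [MeasurableSpace G] where
  μ : 𝒢.Units → Measure G
  regular : ∀ u, (μ u).Regular
  support_eq : ∀ u, (μ u).support = {x | 𝒢.r x = u}
  continuous_integral : ∀ f : G → ℝ, Continuous f → HasCompactSupport f →
    Continuous fun u => ∫ x, f x ∂(μ u)
  left_invariant : ∀ f : G → ℝ, Continuous f → HasCompactSupport f → ∀ x : G,
    (∫ y, (if h : 𝒢.s x = 𝒢.r y then f (𝒢.mul x y h) else 0) ∂(μ ⟨𝒢.s x, 𝒢.r_s x⟩)) =
      ∫ y, f y ∂(μ ⟨𝒢.r x, 𝒢.r_r x⟩)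

end Gpd

/-! ### Actions of groupoids -/

/-- A left action of a groupoid on a set, with moment map `ρ`; `x · t` is defined exactly when
`s x = ρ t`. -/
structure LeftAction {G : Type*} (𝒢 : Gpd G) (T : Type*) where
  ρ : T → G
  ρ_unit : ∀ t, 𝒢.r (ρ t) = ρ t
  act : (x : G) → (t : T) → 𝒢.s x = ρ t → T
  ρ_act : ∀ x t h, ρ (act x t h) = 𝒢.r x
  unit_act : ∀ t, act (ρ t) t (𝒢.s_unit (ρ_unit t)) = t
  mul_act : ∀ x y t (h : 𝒢.s x = 𝒢.r y) (h' : 𝒢.s y = ρ t),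
    act (𝒢.mul x y h) t ((𝒢.s_mul x y h).trans h') = act x (act y t h') (h.trans (ρ_act y t h').symm)

/-- A right action of a groupoid on a set, with moment map `σ`; `t · x` is defined exactly when
`σ t = r x`. -/
structure RightAction {G : Type*} (𝒢 : Gpd G) (T : Type*) where
  σ : T → G
  σ_unit : ∀ t, 𝒢.r (σ t) = σ t
  act : (t : T) → (x : G) → σ t = 𝒢.r x → T
  σ_act : ∀ t x h, σ (act t x h) = 𝒢.s x
  act_unit : ∀ t, act t (σ t) (σ_unit t).symm = t
  act_mul : ∀ t x y (h : σ t = 𝒢.r x) (h' : 𝒢.s x = 𝒢.r y),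
    act t (𝒢.mul x y h') (h.trans (𝒢.r_mul x y h').symm) = act (act t x h) y ((σ_act t x h).trans h')

namespace LeftAction

variable {G T : Type*} {𝒢 : Gpd G} (α : LeftAction 𝒢 T)

theorem act_congr {x x' : G} {t t' : T} (hx : x = x') (ht : t = t') (h : 𝒢.s x = α.ρ t)
    (h' : 𝒢.s x' = α.ρ t') : α.act x t h = α.act x' t' h' := by
  subst hx; subst ht; rfl

theorem act_of_unit {u : G} {t : T} (hu : 𝒢.r u = u) (h : 𝒢.s u = α.ρ t) : α.act u t h = t := by
  have e : u = α.ρ t := by rw [← h, 𝒢.s_unit hu]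
  rw [α.act_congr e rfl h (𝒢.s_unit (α.ρ_unit t)), α.unit_act]

theorem inv_act_act {x : G} {t : T} (h : 𝒢.s x = α.ρ t) :
    α.act (𝒢.inv x) (α.act x t h) ((𝒢.s_inv x).trans (α.ρ_act x t h).symm) = t := by
  rw [← α.mul_act (𝒢.inv x) x t (𝒢.s_inv x) h,
    α.act_congr ((𝒢.inv_mul x).trans h) rfl _ (𝒢.s_unit (α.ρ_unit t)), α.unit_act]

theorem act_inv_act {x : G} {t : T} (h : 𝒢.s (𝒢.inv x) = α.ρ t) :
    α.act x (α.act (𝒢.inv x) t h) ((𝒢.r_inv x).symm.trans (α.ρ_act _ t h).symm) = t := by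
  rw [← α.mul_act x (𝒢.inv x) t (𝒢.r_inv x).symm h,
    α.act_congr ((𝒢.mul_inv x).trans ((𝒢.s_inv x).symm.trans h)) rfl _
      (𝒢.s_unit (α.ρ_unit t)), α.unit_act]

/-- Continuity of the moment map and of the action. -/
structure IsContinuous [TopologicalSpace G] [TopologicalSpace T] : Prop where
  continuous_ρ : Continuous α.ρ
  continuous_act :
    Continuous fun z : {z : G × T // 𝒢.s z.1 = α.ρ z.2} => α.act z.1.1 z.1.2 z.2

/-- A free action: only units fix points. -/
def IsFree : Prop := ∀ x t h, α.act x t h = t → x = α.ρ t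

/-- A proper action: `(x, t) ↦ (x · t, t)` pulls compact sets back to compact sets. -/
def IsProper [TopologicalSpace G] [TopologicalSpace T] : Prop :=
  ∀ C : Set (T × T), IsCompact C →
    IsCompact {z : {z : G × T // 𝒢.s z.1 = α.ρ z.2} | (α.act z.1.1 z.1.2 z.2, z.1.2) ∈ C}

end LeftAction

namespace RightAction

variable {G T : Type*} {𝒢 : Gpd G} (α : RightAction 𝒢 T)

structure IsContinuous [TopologicalSpace G] [TopologicalSpace T] : Prop where
  continuous_σ : Continuous α.σ
  continuous_act :
    Continuous fun z : {z : T × G // α.σ z.1 = 𝒢.r z.2} => α.act z.1.1 z.1.2 z.2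

def IsFree : Prop := ∀ t x h, α.act t x h = t → x = α.σ t

def IsProper [TopologicalSpace G] [TopologicalSpace T] : Prop :=
  ∀ C : Set (T × T), IsCompact C →
    IsCompact {z : {z : T × G // α.σ z.1 = 𝒢.r z.2} | (z.1.1, α.act z.1.1 z.1.2 z.2) ∈ C}

end RightAction

/-- The data of an equivalence `T` between the groupoids `𝒢` and `ℋ`: a left action of `𝒢`, a
right action of `ℋ`, and the translation maps `τl`, `τr`
(see `GpdEquiv.IsEquivalence` for the laws, which determine `τl` and `τr`). -/
structure GpdEquiv {G H : Type*} (𝒢 : Gpd G) (ℋ : Gpd H) (T : Type*) where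
  left : LeftAction 𝒢 T
  right : RightAction ℋ T
  τl : (t t' : T) → right.σ t = right.σ t' → G
  τr : (t t' : T) → left.ρ t = left.ρ t' → H

/-- `T` is a `(𝒢, ℋ)`-equivalence: a locally compact Hausdorff space with commuting free and proper
actions of `𝒢` on the left and `ℋ` on the right, whose moment maps are open and induce bijections
of `T / ℋ` onto the unit space of `𝒢` and of `𝒢 \ T` onto the unit space of `ℋ`. The last two
fields say `τl t t' · t' = t` and `t · τr t t' = t'`. -/
structure GpdEquiv.IsEquivalence {G H T : Type*} {𝒢 : Gpd G} {ℋ : Gpd H}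
    [TopologicalSpace G] [TopologicalSpace H] [TopologicalSpace T]
    (X : GpdEquiv 𝒢 ℋ T) : Prop where
  t2 : T2Space T
  locallyCompact : LocallyCompactSpace T
  left_continuous : X.left.IsContinuous
  left_free : X.left.IsFree
  left_proper : X.left.IsProper
  right_continuous : X.right.IsContinuous
  right_free : X.right.IsFree
  right_proper : X.right.IsProper
  ρ_act : ∀ t y h, X.left.ρ (X.right.act t y h) = X.left.ρ t
  σ_act : ∀ x t h, X.right.σ (X.left.act x t h) = X.right.σ t
  commute : ∀ x t y (h : 𝒢.s x = X.left.ρ t) (h' : X.right.σ t = ℋ.r y),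
    X.right.act (X.left.act x t h) y ((σ_act x t h).trans h') =
      X.left.act x (X.right.act t y h') (h.trans (ρ_act t y h').symm)
  ρ_open : IsOpenMap fun t => (⟨X.left.ρ t, X.left.ρ_unit t⟩ : 𝒢.Units)
  σ_open : IsOpenMap fun t => (⟨X.right.σ t, X.right.σ_unit t⟩ : ℋ.Units)
  ρ_surj : ∀ u : 𝒢.Units, ∃ t, X.left.ρ t = u
  σ_surj : ∀ u : ℋ.Units, ∃ t, X.right.σ t = u
  ρ_inj : ∀ t t', X.left.ρ t = X.left.ρ t' → ∃ y h, X.right.act t y h = t'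
  σ_inj : ∀ t t', X.right.σ t = X.right.σ t' → ∃ x h, X.left.act x t h = t'
  τl_spec : ∀ t t' h, ∃ h', X.left.act (X.τl t t' h) t' h' = t
  τr_spec : ∀ t t' h, ∃ h', X.right.act t (X.τr t t' h) h' = t'

/-! ### Banach bundles and C*-algebraic fibres -/

/-- The total space of a family of fibres. -/
@[ext] structure Tot {X : Type*} (F : X → Type*) where
  base : X
  val : F base

/-- The data of a bundle of complex normed spaces over `X`: the fibres and a topology on the
total space. -/
structure NBundle.{u, v} (X : Type u) where
  Fib : X → Type v
  normed : ∀ x, NormedAddCommGroup (Fib x)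
  space : ∀ x, NormedSpace ℂ (Fib x)
  top : TopologicalSpace (Tot Fib)

attribute [instance] NBundle.normed NBundle.space NBundle.top

namespace NBundle

variable {X Y : Type*}

/-- Transport between equal fibres. -/
def cast (E : NBundle X) {x y : X} (h : x = y) : E.Fib x → E.Fib y := fun a => h ▸ a

/-- An upper semicontinuous Banach bundle. (The projection is surjective because every fibre has a
zero; the last field is the condition that `a i → 0` in the fibre over `x` whenever
`base (a i) → x` and `‖a i‖ → 0`.) -/
structure IsBanachBundle [TopologicalSpace X] (E : NBundle X) : Prop where
  complete : ∀ x, CompleteSpace (E.Fib x)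
  continuous_proj : Continuous fun a : Tot E.Fib => a.base
  open_proj : IsOpenMap fun a : Tot E.Fib => a.base
  usc_norm : UpperSemicontinuous fun a : Tot E.Fib => ‖a.val‖
  continuous_add : Continuous fun z : {z : Tot E.Fib × Tot E.Fib // z.1.base = z.2.base} =>
    (⟨z.1.1.base, z.1.1.val + E.cast z.2.symm z.1.2.val⟩ : Tot E.Fib)
  continuous_smul : ∀ c : ℂ, Continuous fun a : Tot E.Fib => (⟨a.base, c • a.val⟩ : Tot E.Fib)
  tendsto_zero : ∀ (x : X) (l : Filter (Tot E.Fib)), Tendsto (fun a => a.base) l (𝓝 x) →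
    Tendsto (fun a => ‖a.val‖) l (𝓝 0) → l ≤ 𝓝 (⟨x, 0⟩ : Tot E.Fib)

/-- The pullback of a bundle along `f`, with the relative topology of `Tot × X`. -/
def pullback [TopologicalSpace X] (E : NBundle Y) (f : X → Y) : NBundle X where
  Fib x := E.Fib (f x)
  normed x := E.normed (f x)
  space x := E.space (f x)
  top := TopologicalSpace.induced
    (fun a => ((⟨f a.base, a.val⟩ : Tot E.Fib), a.base)) inferInstance

end NBundle

/-- The operations `m` and `st` make the normed space `A` a C*-algebra. -/
structure IsCStar {A : Type*} [NormedAddCommGroup A] [NormedSpace ℂ A]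
    (m : A → A → A) (st : A → A) : Prop where
  complete : CompleteSpace A
  add_mul : ∀ a b c, m (a + b) c = m a c + m b c
  mul_add : ∀ a b c, m a (b + c) = m a b + m a c
  smul_mul : ∀ (z : ℂ) a b, m (z • a) b = z • m a b
  mul_smul : ∀ (z : ℂ) a b, m a (z • b) = z • m a b
  mul_assoc : ∀ a b c, m (m a b) c = m a (m b c)
  star_add : ∀ a b, st (a + b) = st a + st b
  star_smul : ∀ (z : ℂ) a, st (z • a) = (starRingEnd ℂ z) • st a
  star_star : ∀ a, st (st a) = a
  star_mul : ∀ a b, st (m a b) = m (st b) (st a)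
  norm_mul_le : ∀ a b, ‖m a b‖ ≤ ‖a‖ * ‖b‖
  norm_star_mul_self : ∀ a, ‖m (st a) a‖ = ‖a‖ ^ 2

/-- `E` is an `A`-`B` imprimitivity bimodule: it is a full left Hilbert `A`-module and a full right
Hilbert `B`-module, its given norm is the Hilbert module norm on either side, each algebra acts by
adjointable operators for the inner product of the other, and `⟪e, f⟫_A g = e ⟪f, g⟫_B`. -/
structure IsImprimitivityBimodule {A B E : Type*}
    [NormedAddCommGroup A] [NormedSpace ℂ A] [NormedAddCommGroup B] [NormedSpace ℂ B]
    [NormedAddCommGroup E] [NormedSpace ℂ E]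
    (mA : A → A → A) (sA : A → A) (mB : B → B → B) (sB : B → B)
    (lact : A → E → E) (ract : E → B → E) (lip : E → E → A) (rip : E → E → B) : Prop where
  left_cstar : IsCStar mA sA
  right_cstar : IsCStar mB sB
  complete : CompleteSpace E
  lact_add_left : ∀ a b e, lact (a + b) e = lact a e + lact b e
  lact_add_right : ∀ a e f, lact a (e + f) = lact a e + lact a f
  lact_smul_left : ∀ (z : ℂ) a e, lact (z • a) e = z • lact a e
  lact_smul_right : ∀ (z : ℂ) a e, lact a (z • e) = z • lact a e
  lact_mul : ∀ a b e, lact (mA a b) e = lact a (lact b e)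
  ract_add_left : ∀ e f b, ract (e + f) b = ract e b + ract f b
  ract_add_right : ∀ e a b, ract e (a + b) = ract e a + ract e b
  ract_smul_left : ∀ (z : ℂ) e b, ract (z • e) b = z • ract e b
  ract_smul_right : ∀ (z : ℂ) e b, ract e (z • b) = z • ract e b
  ract_mul : ∀ e a b, ract e (mB a b) = ract (ract e a) b
  lact_ract : ∀ a e b, ract (lact a e) b = lact a (ract e b)
  lip_add_left : ∀ e f g, lip (e + f) g = lip e g + lip f g
  lip_smul_left : ∀ (z : ℂ) e f, lip (z • e) f = z • lip e f
  lip_star : ∀ e f, sA (lip e f) = lip f e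
  lip_lact : ∀ a e f, lip (lact a e) f = mA a (lip e f)
  lip_ract : ∀ e f b, lip (ract e b) f = lip e (ract f (sB b))
  lip_pos : ∀ e, ∃ a, lip e e = mA (sA a) a
  norm_lip : ∀ e, ‖lip e e‖ = ‖e‖ ^ 2
  lip_full : Dense (Submodule.span ℂ {a | ∃ e f, lip e f = a} : Set A)
  rip_add_right : ∀ e f g, rip e (f + g) = rip e f + rip e g
  rip_smul_right : ∀ (z : ℂ) e f, rip e (z • f) = z • rip e f
  rip_star : ∀ e f, sB (rip e f) = rip f e
  rip_ract : ∀ e f b, rip e (ract f b) = mB (rip e f) b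
  rip_lact : ∀ a e f, rip (lact a e) f = rip e (lact (sA a) f)
  rip_pos : ∀ e, ∃ b, rip e e = mB (sB b) b
  norm_rip : ∀ e, ‖rip e e‖ = ‖e‖ ^ 2
  rip_full : Dense (Submodule.span ℂ {b | ∃ e f, rip e f = b} : Set B)
  lip_act : ∀ e f g, lact (lip e f) g = ract e (rip f g)

/-! ### Fell bundles -/

/-- The data of a Fell bundle over a groupoid: a bundle with a multiplication covering the
multiplication of the groupoid and an involution covering the inversion. -/
structure FellBundle.{u, v} {G : Type u} (𝒢 : Gpd G) extends NBundle.{u, v} G where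
  mul : ∀ {x y} (h : 𝒢.s x = 𝒢.r y), Fib x → Fib y → Fib (𝒢.mul x y h)
  star : ∀ {x}, Fib x → Fib (𝒢.inv x)

namespace FellBundle

variable {G : Type*} {𝒢 : Gpd G} (A : FellBundle 𝒢)

/-- The multiplication of the fibre over a unit. -/
def unitMul {u : G} (hu : 𝒢.r u = u) (a b : A.Fib u) : A.Fib u :=
  A.cast (𝒢.unit_mul hu ((𝒢.s_unit hu).trans hu.symm))
    (A.mul ((𝒢.s_unit hu).trans hu.symm) a b)

/-- The involution of the fibre over a unit. -/
def unitStar {u : G} (hu : 𝒢.r u = u) (a : A.Fib u) : A.Fib u :=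
  A.cast (𝒢.inv_unit hu) (A.star a)

/-- The laws of a (saturated) Fell bundle over a locally compact Hausdorff groupoid. Equations
between elements of different fibres are equations in the total space. -/
structure IsFell [TopologicalSpace G] : Prop where
  banach : A.IsBanachBundle
  continuous_mul :
    Continuous fun z : {z : Tot A.Fib × Tot A.Fib // 𝒢.s z.1.base = 𝒢.r z.2.base} =>
      (⟨_, A.mul z.2 z.1.1.val z.1.2.val⟩ : Tot A.Fib)
  continuous_star : Continuous fun a : Tot A.Fib => (⟨_, A.star a.val⟩ : Tot A.Fib)
  add_mul : ∀ {x y} (h : 𝒢.s x = 𝒢.r y) (a b : A.Fib x) (c : A.Fib y),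
    A.mul h (a + b) c = A.mul h a c + A.mul h b c
  mul_add : ∀ {x y} (h : 𝒢.s x = 𝒢.r y) (a : A.Fib x) (b c : A.Fib y),
    A.mul h a (b + c) = A.mul h a b + A.mul h a c
  smul_mul : ∀ {x y} (h : 𝒢.s x = 𝒢.r y) (z : ℂ) (a : A.Fib x) (b : A.Fib y),
    A.mul h (z • a) b = z • A.mul h a b
  mul_smul : ∀ {x y} (h : 𝒢.s x = 𝒢.r y) (z : ℂ) (a : A.Fib x) (b : A.Fib y),
    A.mul h a (z • b) = z • A.mul h a b
  mul_assoc : ∀ {x y z} (h₁ : 𝒢.s x = 𝒢.r y) (h₂ : 𝒢.s y = 𝒢.r z)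
    (a : A.Fib x) (b : A.Fib y) (c : A.Fib z),
    (⟨_, A.mul ((𝒢.s_mul x y h₁).trans h₂) (A.mul h₁ a b) c⟩ : Tot A.Fib) =
      ⟨_, A.mul (h₁.trans (𝒢.r_mul y z h₂).symm) a (A.mul h₂ b c)⟩
  star_add : ∀ {x} (a b : A.Fib x), A.star (a + b) = A.star a + A.star b
  star_smul : ∀ {x} (z : ℂ) (a : A.Fib x), A.star (z • a) = (starRingEnd ℂ z) • A.star a
  star_star : ∀ {x} (a : A.Fib x), (⟨_, A.star (A.star a)⟩ : Tot A.Fib) = ⟨_, a⟩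
  star_mul : ∀ {x y} (h : 𝒢.s x = 𝒢.r y) (a : A.Fib x) (b : A.Fib y),
    (⟨_, A.star (A.mul h a b)⟩ : Tot A.Fib) =
      ⟨_, A.mul ((𝒢.s_inv y).trans (h.symm.trans (𝒢.r_inv x).symm)) (A.star b) (A.star a)⟩
  cstar : ∀ {u} (hu : 𝒢.r u = u), IsCStar (A.unitMul hu) (A.unitStar hu)
  imprimitivity : ∀ x, IsImprimitivityBimodule
    (A.unitMul (𝒢.r_r x)) (A.unitStar (𝒢.r_r x)) (A.unitMul (𝒢.r_s x)) (A.unitStar (𝒢.r_s x))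
    (fun (a : A.Fib (𝒢.r x)) (e : A.Fib x) => A.cast (𝒢.r_unit_mul x) (A.mul (𝒢.s_r x) a e))
    (fun (e : A.Fib x) (b : A.Fib (𝒢.s x)) =>
      A.cast (𝒢.mul_s_unit x) (A.mul (𝒢.r_s x).symm e b))
    (fun e f : A.Fib x => A.cast (𝒢.mul_inv x) (A.mul (𝒢.r_inv x).symm e (A.star f)))
    (fun e f : A.Fib x => A.cast (𝒢.inv_mul x) (A.mul (𝒢.s_inv x) (A.star e) f))

end FellBundle

/-! ### Equivalence of Fell bundles -/

section Equivalence

variable {G H T : Type*} {𝒢 : Gpd G} {ℋ : Gpd H}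

/-- The data of an equivalence between Fell bundles over `𝒢` and `ℋ` on a bundle `E` over `T`:
actions covering those of the groupoids, and inner products covering the translation maps. -/
structure FellEquiv (X : GpdEquiv 𝒢 ℋ T) (A : FellBundle 𝒢) (B : FellBundle ℋ)
    (E : NBundle T) where
  lact : ∀ {x t} (h : 𝒢.s x = X.left.ρ t), A.Fib x → E.Fib t → E.Fib (X.left.act x t h)
  ract : ∀ {t y} (h : X.right.σ t = ℋ.r y), E.Fib t → B.Fib y → E.Fib (X.right.act t y h)
  lip : ∀ {t t'} (h : X.right.σ t = X.right.σ t'), E.Fib t → E.Fib t' → A.Fib (X.τl t t' h)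
  rip : ∀ {t t'} (h : X.left.ρ t = X.left.ρ t'), E.Fib t → E.Fib t' → B.Fib (X.τr t t' h)

/-- `E` is an `A`-`B` equivalence. -/
structure FellEquiv.IsEquivalence [TopologicalSpace G] [TopologicalSpace H] [TopologicalSpace T]
    {X : GpdEquiv 𝒢 ℋ T} {A : FellBundle 𝒢} {B : FellBundle ℋ} {E : NBundle T}
    (Φ : FellEquiv X A B E) : Prop where
  left_groupoid : 𝒢.IsLocallyCompact
  right_groupoid : ℋ.IsLocallyCompact
  groupoid_equivalence : X.IsEquivalence
  left_fell : A.IsFell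
  right_fell : B.IsFell
  banach : E.IsBanachBundle
  /- the left action -/
  continuous_lact :
    Continuous fun z : {z : Tot A.Fib × Tot E.Fib // 𝒢.s z.1.base = X.left.ρ z.2.base} =>
      (⟨_, Φ.lact z.2 z.1.1.val z.1.2.val⟩ : Tot E.Fib)
  lact_add_left : ∀ {x t} (h : 𝒢.s x = X.left.ρ t) (a b : A.Fib x) (e : E.Fib t),
    Φ.lact h (a + b) e = Φ.lact h a e + Φ.lact h b e
  lact_add_right : ∀ {x t} (h : 𝒢.s x = X.left.ρ t) (a : A.Fib x) (e f : E.Fib t),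
    Φ.lact h a (e + f) = Φ.lact h a e + Φ.lact h a f
  lact_smul_left : ∀ {x t} (h : 𝒢.s x = X.left.ρ t) (z : ℂ) (a : A.Fib x) (e : E.Fib t),
    Φ.lact h (z • a) e = z • Φ.lact h a e
  lact_smul_right : ∀ {x t} (h : 𝒢.s x = X.left.ρ t) (z : ℂ) (a : A.Fib x) (e : E.Fib t),
    Φ.lact h a (z • e) = z • Φ.lact h a e
  lact_mul : ∀ {x y t} (h : 𝒢.s x = 𝒢.r y) (h' : 𝒢.s y = X.left.ρ t)
    (a : A.Fib x) (b : A.Fib y) (e : E.Fib t),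
    (⟨_, Φ.lact ((𝒢.s_mul x y h).trans h') (A.mul h a b) e⟩ : Tot E.Fib) =
      ⟨_, Φ.lact (h.trans (X.left.ρ_act y t h').symm) a (Φ.lact h' b e)⟩
  norm_lact_le : ∀ {x t} (h : 𝒢.s x = X.left.ρ t) (a : A.Fib x) (e : E.Fib t),
    ‖Φ.lact h a e‖ ≤ ‖a‖ * ‖e‖
  /- the right action -/
  continuous_ract :
    Continuous fun z : {z : Tot E.Fib × Tot B.Fib // X.right.σ z.1.base = ℋ.r z.2.base} =>
      (⟨_, Φ.ract z.2 z.1.1.val z.1.2.val⟩ : Tot E.Fib)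
  ract_add_left : ∀ {t y} (h : X.right.σ t = ℋ.r y) (e f : E.Fib t) (b : B.Fib y),
    Φ.ract h (e + f) b = Φ.ract h e b + Φ.ract h f b
  ract_add_right : ∀ {t y} (h : X.right.σ t = ℋ.r y) (e : E.Fib t) (b c : B.Fib y),
    Φ.ract h e (b + c) = Φ.ract h e b + Φ.ract h e c
  ract_smul_left : ∀ {t y} (h : X.right.σ t = ℋ.r y) (z : ℂ) (e : E.Fib t) (b : B.Fib y),
    Φ.ract h (z • e) b = z • Φ.ract h e b
  ract_smul_right : ∀ {t y} (h : X.right.σ t = ℋ.r y) (z : ℂ) (e : E.Fib t) (b : B.Fib y),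
    Φ.ract h e (z • b) = z • Φ.ract h e b
  ract_mul : ∀ {t x y} (h : X.right.σ t = ℋ.r x) (h' : ℋ.s x = ℋ.r y)
    (e : E.Fib t) (b : B.Fib x) (c : B.Fib y),
    (⟨_, Φ.ract (h.trans (ℋ.r_mul x y h').symm) e (B.mul h' b c)⟩ : Tot E.Fib) =
      ⟨_, Φ.ract ((X.right.σ_act t x h).trans h') (Φ.ract h e b) c⟩
  norm_ract_le : ∀ {t y} (h : X.right.σ t = ℋ.r y) (e : E.Fib t) (b : B.Fib y),
    ‖Φ.ract h e b‖ ≤ ‖e‖ * ‖b‖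
  commute : ∀ {x t y} (h : 𝒢.s x = X.left.ρ t) (h' : X.right.σ t = ℋ.r y)
    (a : A.Fib x) (e : E.Fib t) (b : B.Fib y),
    (⟨_, Φ.ract ((groupoid_equivalence.σ_act x t h).trans h') (Φ.lact h a e) b⟩ : Tot E.Fib) =
      ⟨_, Φ.lact (h.trans (groupoid_equivalence.ρ_act t y h').symm) a (Φ.ract h' e b)⟩
  /- the inner products -/
  lip_add_left : ∀ {t t'} (h : X.right.σ t = X.right.σ t') (e f : E.Fib t) (g : E.Fib t'),
    Φ.lip h (e + f) g = Φ.lip h e g + Φ.lip h f g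
  lip_smul_left : ∀ {t t'} (h : X.right.σ t = X.right.σ t') (z : ℂ) (e : E.Fib t) (f : E.Fib t'),
    Φ.lip h (z • e) f = z • Φ.lip h e f
  lip_add_right : ∀ {t t'} (h : X.right.σ t = X.right.σ t') (e : E.Fib t) (f g : E.Fib t'),
    Φ.lip h e (f + g) = Φ.lip h e f + Φ.lip h e g
  lip_smul_right : ∀ {t t'} (h : X.right.σ t = X.right.σ t') (z : ℂ) (e : E.Fib t) (f : E.Fib t'),
    Φ.lip h e (z • f) = (starRingEnd ℂ z) • Φ.lip h e f
  rip_add_left : ∀ {t t'} (h : X.left.ρ t = X.left.ρ t') (e f : E.Fib t) (g : E.Fib t'),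
    Φ.rip h (e + f) g = Φ.rip h e g + Φ.rip h f g
  rip_smul_left : ∀ {t t'} (h : X.left.ρ t = X.left.ρ t') (z : ℂ) (e : E.Fib t) (f : E.Fib t'),
    Φ.rip h (z • e) f = (starRingEnd ℂ z) • Φ.rip h e f
  rip_add_right : ∀ {t t'} (h : X.left.ρ t = X.left.ρ t') (e : E.Fib t) (f g : E.Fib t'),
    Φ.rip h e (f + g) = Φ.rip h e f + Φ.rip h e g
  rip_smul_right : ∀ {t t'} (h : X.left.ρ t = X.left.ρ t') (z : ℂ) (e : E.Fib t) (f : E.Fib t'),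
    Φ.rip h e (z • f) = z • Φ.rip h e f
  lip_star : ∀ {t t'} (h : X.right.σ t = X.right.σ t') (e : E.Fib t) (f : E.Fib t'),
    (⟨_, A.star (Φ.lip h e f)⟩ : Tot A.Fib) = ⟨_, Φ.lip h.symm f e⟩
  rip_star : ∀ {t t'} (h : X.left.ρ t = X.left.ρ t') (e : E.Fib t) (f : E.Fib t'),
    (⟨_, B.star (Φ.rip h e f)⟩ : Tot B.Fib) = ⟨_, Φ.rip h.symm f e⟩
  lip_lact : ∀ {x t t'} (hx : 𝒢.s x = X.left.ρ t) (h : X.right.σ t = X.right.σ t'),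
    ∃ h' : 𝒢.s x = 𝒢.r (X.τl t t' h), ∀ (a : A.Fib x) (e : E.Fib t) (f : E.Fib t'),
    (⟨_, Φ.lip ((groupoid_equivalence.σ_act x t hx).trans h) (Φ.lact hx a e) f⟩ : Tot A.Fib) =
      ⟨_, A.mul h' a (Φ.lip h e f)⟩
  rip_ract : ∀ {t t' y} (h : X.left.ρ t = X.left.ρ t') (hy : X.right.σ t' = ℋ.r y),
    ∃ h' : ℋ.s (X.τr t t' h) = ℋ.r y, ∀ (e : E.Fib t) (f : E.Fib t') (b : B.Fib y),
    (⟨_, Φ.rip (h.trans (groupoid_equivalence.ρ_act t' y hy).symm) e (Φ.ract hy f b)⟩ :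
      Tot B.Fib) = ⟨_, B.mul h' (Φ.rip h e f) b⟩
  lip_act : ∀ {t t' t''} (h : X.right.σ t = X.right.σ t') (h' : X.left.ρ t' = X.left.ρ t''),
    ∃ (h₁ : 𝒢.s (X.τl t t' h) = X.left.ρ t'') (h₂ : X.right.σ t = ℋ.r (X.τr t' t'' h')),
    ∀ (e : E.Fib t) (f : E.Fib t') (g : E.Fib t''),
    (⟨_, Φ.lact h₁ (Φ.lip h e f) g⟩ : Tot E.Fib) = ⟨_, Φ.ract h₂ e (Φ.rip h' f g)⟩
  /- the fibres -/
  imprimitivity : ∀ t, ∃ (hl : X.τl t t rfl = X.left.ρ t) (hr : X.τr t t rfl = X.right.σ t),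
    IsImprimitivityBimodule
      (A.unitMul (X.left.ρ_unit t)) (A.unitStar (X.left.ρ_unit t))
      (B.unitMul (X.right.σ_unit t)) (B.unitStar (X.right.σ_unit t))
      (fun (a : A.Fib (X.left.ρ t)) (e : E.Fib t) =>
        E.cast (X.left.unit_act t) (Φ.lact (𝒢.s_unit (X.left.ρ_unit t)) a e))
      (fun (e : E.Fib t) (b : B.Fib (X.right.σ t)) =>
        E.cast (X.right.act_unit t) (Φ.ract (X.right.σ_unit t).symm e b))
      (fun e f : E.Fib t => A.cast hl (Φ.lip rfl e f))
      (fun e f : E.Fib t => B.cast hr (Φ.rip rfl e f))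

end Equivalence

/-! ### Action groupoids and action Fell bundles -/

namespace LeftAction

variable {K T : Type*} {𝒦 : Gpd K} (α : LeftAction 𝒦 T)

/-- The arrows `(k, t)`, with `s k = ρ t`, of the action groupoid. -/
abbrev Arrows : Type _ := {z : K × T // 𝒦.s z.1 = α.ρ z.2}

/-- The action groupoid: `r (k, t) = k · t`, `s (k, t) = t` and `(k, l · t) (l, t) = (k l, t)`, where
the point `t` of `T` is identified with the unit `(ρ t, t)`. -/
def groupoid : Gpd α.Arrows where
  r z := ⟨(𝒦.r z.1.1, α.act z.1.1 z.1.2 z.2), by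
    change 𝒦.s (𝒦.r z.1.1) = α.ρ (α.act _ _ _)
    rw [𝒦.s_r, α.ρ_act]⟩
  s z := ⟨(𝒦.s z.1.1, z.1.2), (𝒦.s_s _).trans z.2⟩
  inv z := ⟨(𝒦.inv z.1.1, α.act z.1.1 z.1.2 z.2), (𝒦.s_inv _).trans (α.ρ_act _ _ _).symm⟩
  mul z w h := ⟨(𝒦.mul z.1.1 w.1.1 (congrArg (fun a : α.Arrows => a.1.1) h), w.1.2),
    (𝒦.s_mul _ _ _).trans w.2⟩
  s_r z := by ext <;> simp [𝒦.s_r]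
  r_s z := by
    ext
    · exact 𝒦.r_s _
    · exact α.act_of_unit (𝒦.r_s _) _
  r_mul z w h := by
    have h₁ : 𝒦.s z.1.1 = 𝒦.r w.1.1 := congrArg (fun a : α.Arrows => a.1.1) h
    have h₂ : z.1.2 = α.act w.1.1 w.1.2 w.2 := congrArg (fun a : α.Arrows => a.1.2) h
    ext
    · exact 𝒦.r_mul _ _ _
    · exact (α.mul_act _ _ _ h₁ w.2).trans (α.act_congr rfl h₂.symm _ _)
  s_mul z w h := by
    ext
    · exact 𝒦.s_mul _ _ _
    · rfl
  mul_assoc x y z h₁ h₂ := by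
    ext
    · exact 𝒦.mul_assoc _ _ _ (congrArg (fun a : α.Arrows => a.1.1) h₁)
        (congrArg (fun a : α.Arrows => a.1.1) h₂)
    · rfl
  r_unit_mul z := by
    ext
    · exact 𝒦.r_unit_mul _
    · rfl
  mul_s_unit z := by
    ext
    · exact 𝒦.mul_s_unit _
    · rfl
  r_inv z := by
    ext
    · exact 𝒦.r_inv _
    · exact α.inv_act_act z.2
  s_inv z := by
    ext
    · exact 𝒦.s_inv _
    · rfl
  mul_inv z := by
    ext
    · exact 𝒦.mul_inv _
    · rfl
  inv_mul z := by
    ext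
    · exact 𝒦.inv_mul _
    · rfl

/-- The action Fell bundle over the action groupoid: the fibre over `(k, t)` is `B(k)`, with
`(b, p(b') · t) (b', t) = (b b', t)` and `(b, t)* = (b*, p(b) · t)`. -/
def fellBundle [TopologicalSpace K] [TopologicalSpace T] (B : FellBundle 𝒦) :
    FellBundle α.groupoid where
  toNBundle := B.toNBundle.pullback fun z : α.Arrows => z.1.1
  mul {z w} h b c := B.mul (x := z.1.1) (y := w.1.1) (congrArg (fun a : α.Arrows => a.1.1) h) b c
  star {z} b := B.star (x := z.1.1) b

/-- The right action of `𝒦` on its action groupoid: `(k, t) · l = (k l, l⁻¹ · t)`. -/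
def rightOnArrows : RightAction 𝒦 α.Arrows where
  σ z := 𝒦.s z.1.1
  σ_unit z := 𝒦.r_s _
  act z l h := ⟨(𝒦.mul z.1.1 l h, α.act (𝒦.inv l) z.1.2
      ((𝒦.s_inv l).trans (h.symm.trans z.2))), by
    change 𝒦.s (𝒦.mul _ _ _) = α.ρ (α.act _ _ _)
    rw [𝒦.s_mul, α.ρ_act, 𝒦.r_inv]⟩
  σ_act z l h := 𝒦.s_mul _ _ _
  act_unit z := by
    ext
    · exact 𝒦.mul_s_unit _
    · refine α.act_of_unit ?_ _
      rw [𝒦.inv_unit (𝒦.r_s _), 𝒦.r_s]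
  act_mul z l m h h' := by
    ext
    · exact (𝒦.mul_assoc _ _ _ h h').symm
    · refine (α.act_congr (𝒦.inv_of_mul h') rfl _ ?_).trans
        (α.mul_act (𝒦.inv m) (𝒦.inv l) z.1.2 _ ((𝒦.s_inv l).trans (h.symm.trans z.2)))
      exact (𝒦.s_mul _ _ _).trans ((𝒦.s_inv l).trans (h.symm.trans z.2))

end LeftAction

/-! ### Actions by isomorphisms and semidirect products -/

section Semidirect

variable {G H : Type*} {𝒢 : Gpd G} {ℋ : Gpd H}

/-- The action of `𝒢` on the set of arrows of `ℋ` is by groupoid isomorphisms: each `x` gives an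
isomorphism `h ↦ x · h` of `ρ⁻¹(s x)` onto `ρ⁻¹(r x)`. -/
structure LeftAction.ByIsomorphisms (β : LeftAction 𝒢 H) (ℋ : Gpd H) : Prop where
  ρ_r : ∀ h, β.ρ (ℋ.r h) = β.ρ h
  ρ_s : ∀ h, β.ρ (ℋ.s h) = β.ρ h
  r_act : ∀ x h hx, ℋ.r (β.act x h hx) = β.act x (ℋ.r h) (hx.trans (ρ_r h).symm)
  s_act : ∀ x h hx, ℋ.s (β.act x h hx) = β.act x (ℋ.s h) (hx.trans (ρ_s h).symm)
  act_mul : ∀ x h k (e : ℋ.s h = ℋ.r k) hx hh hk e',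
    β.act x (ℋ.mul h k e) hx = ℋ.mul (β.act x h hh) (β.act x k hk) e'

namespace LeftAction.ByIsomorphisms

theorem ρ_inv {β : LeftAction 𝒢 H} (hβ : β.ByIsomorphisms ℋ) (h : H) :
    β.ρ (ℋ.inv h) = β.ρ h := by
  rw [← hβ.ρ_r (ℋ.inv h), ℋ.r_inv, hβ.ρ_s]

theorem ρ_mul {β : LeftAction 𝒢 H} (hβ : β.ByIsomorphisms ℋ) (h k : H) (e : ℋ.s h = ℋ.r k) :
    β.ρ (ℋ.mul h k e) = β.ρ h := by
  rw [← hβ.ρ_r, ℋ.r_mul, hβ.ρ_r]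

theorem inv_act {β : LeftAction 𝒢 H} (hβ : β.ByIsomorphisms ℋ) (x : G) (h : H)
    (hx : 𝒢.s x = β.ρ h) :
    ℋ.inv (β.act x h hx) = β.act x (ℋ.inv h) (hx.trans (hβ.ρ_inv h).symm) := by
  have e : ℋ.s (β.act x h hx) = ℋ.r (β.act x (ℋ.inv h) (hx.trans (hβ.ρ_inv h).symm)) := by
    rw [hβ.s_act, hβ.r_act]
    exact β.act_congr rfl (ℋ.r_inv h).symm _ _
  apply ℋ.inv_eq_of_mul e
  rw [← hβ.act_mul x h (ℋ.inv h) (ℋ.r_inv h).symm (by rw [hβ.ρ_mul]; exact hx), hβ.r_act]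
  exact β.act_congr rfl (ℋ.mul_inv h) _ _

/-- The arrows `(h, x)`, with `ρ h = r x`, of the semidirect product groupoid. -/
abbrev Arrows {β : LeftAction 𝒢 H} (_ : β.ByIsomorphisms ℋ) : Type _ :=
  {z : H × G // β.ρ z.1 = 𝒢.r z.2}

/-- If `(h, x)` and `(k, y)` satisfy `s (h, x) = r (k, y)`, then `h (x · k)` is defined. -/
theorem composable {β : LeftAction 𝒢 H} (hβ : β.ByIsomorphisms ℋ) {h k : H} {x : G}
    (hh : 𝒢.s (𝒢.inv x) = β.ρ (ℋ.s h)) (e : β.act (𝒢.inv x) (ℋ.s h) hh = ℋ.r k)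
    (hk : 𝒢.s x = β.ρ k) : ℋ.s h = ℋ.r (β.act x k hk) := by
  rw [hβ.r_act, ← β.act_inv_act hh]
  exact β.act_congr rfl e _ _

/-- The semidirect product groupoid `ℋ ⋊ 𝒢`: `r (h, x) = (r h, r x)`,
`s (h, x) = (x⁻¹ · s h, s x)`, `(h, x) (k, y) = (h (x · k), x y)` and
`(h, x)⁻¹ = (x⁻¹ · h⁻¹, x⁻¹)`. -/
def semidirect {β : LeftAction 𝒢 H} (hβ : β.ByIsomorphisms ℋ) : Gpd hβ.Arrows where
  r z := ⟨(ℋ.r z.1.1, 𝒢.r z.1.2), by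
    change β.ρ (ℋ.r _) = 𝒢.r (𝒢.r _)
    rw [hβ.ρ_r, 𝒢.r_r]
    exact z.2⟩
  s z := ⟨(β.act (𝒢.inv z.1.2) (ℋ.s z.1.1)
      ((𝒢.s_inv _).trans (z.2.symm.trans (hβ.ρ_s _).symm)), 𝒢.s z.1.2), by
    change β.ρ (β.act _ _ _) = 𝒢.r (𝒢.s _)
    rw [β.ρ_act, 𝒢.r_inv, 𝒢.r_s]⟩
  inv z := ⟨(β.act (𝒢.inv z.1.2) (ℋ.inv z.1.1)
      ((𝒢.s_inv _).trans (z.2.symm.trans (hβ.ρ_inv _).symm)), 𝒢.inv z.1.2), β.ρ_act _ _ _⟩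
  mul z w e := ⟨(ℋ.mul z.1.1 (β.act z.1.2 w.1.1
        ((congrArg (fun a : hβ.Arrows => a.1.2) e).trans w.2.symm))
      (hβ.composable _ (congrArg (fun a : hβ.Arrows => a.1.1) e) _),
      𝒢.mul z.1.2 w.1.2 (congrArg (fun a : hβ.Arrows => a.1.2) e)), by
    change β.ρ (ℋ.mul _ _ _) = 𝒢.r (𝒢.mul _ _ _)
    rw [hβ.ρ_mul, 𝒢.r_mul]
    exact z.2⟩
  s_r z := by
    ext
    · refine (β.act_of_unit ?_ _).trans (ℋ.s_r _)
      change 𝒢.r (𝒢.inv (𝒢.r _)) = 𝒢.inv (𝒢.r _)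
      rw [𝒢.inv_unit (𝒢.r_r _), 𝒢.r_r]
    · exact 𝒢.s_r _
  r_s z := by
    ext
    · exact (hβ.r_act _ _ _).trans (β.act_congr rfl (ℋ.r_s _) _ _)
    · exact 𝒢.r_s _
  r_mul z w e := by
    ext
    · exact ℋ.r_mul _ _ _
    · exact 𝒢.r_mul _ _ _
  s_mul z w e := by
    have hx : 𝒢.s z.1.2 = 𝒢.r w.1.2 := congrArg (fun a : hβ.Arrows => a.1.2) e
    have hk : 𝒢.s z.1.2 = β.ρ w.1.1 := hx.trans w.2.symm
    have hk' : 𝒢.s z.1.2 = β.ρ (ℋ.s w.1.1) := hk.trans (hβ.ρ_s _).symm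
    ext
    · have e₁ : ℋ.s (ℋ.mul z.1.1 (β.act z.1.2 w.1.1 hk)
          (hβ.composable _ (congrArg (fun a : hβ.Arrows => a.1.1) e) _)) =
          β.act z.1.2 (ℋ.s w.1.1) hk' := (ℋ.s_mul _ _ _).trans (hβ.s_act _ _ _)
      have h₁ : 𝒢.s (𝒢.inv w.1.2) = 𝒢.r (𝒢.inv z.1.2) := by rw [𝒢.s_inv, 𝒢.r_inv, hx]
      have h₂ : 𝒢.s (𝒢.inv z.1.2) = β.ρ (β.act z.1.2 (ℋ.s w.1.1) hk') := by
        rw [𝒢.s_inv, β.ρ_act]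
      refine (β.act_congr (𝒢.inv_of_mul hx) e₁ _ ((𝒢.s_mul _ _ h₁).trans h₂)).trans ?_
      refine (β.mul_act _ _ _ h₁ h₂).trans ?_
      exact β.act_congr rfl (β.inv_act_act hk') _ _
    · exact 𝒢.s_mul _ _ _
  mul_assoc x y z e₁ e₂ := by
    have hx : 𝒢.s x.1.2 = 𝒢.r y.1.2 := congrArg (fun a : hβ.Arrows => a.1.2) e₁
    have hy : 𝒢.s y.1.2 = 𝒢.r z.1.2 := congrArg (fun a : hβ.Arrows => a.1.2) e₂
    have hk : 𝒢.s x.1.2 = β.ρ y.1.1 := hx.trans y.2.symm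
    have hl : 𝒢.s y.1.2 = β.ρ z.1.1 := hy.trans z.2.symm
    have hyz : ℋ.s y.1.1 = ℋ.r (β.act y.1.2 z.1.1 hl) :=
      hβ.composable _ (congrArg (fun a : hβ.Arrows => a.1.1) e₂) _
    have hxy : ℋ.s x.1.1 = ℋ.r (β.act x.1.2 y.1.1 hk) :=
      hβ.composable _ (congrArg (fun a : hβ.Arrows => a.1.1) e₁) _
    have hl' : 𝒢.s x.1.2 = β.ρ (β.act y.1.2 z.1.1 hl) := hx.trans (β.ρ_act _ _ _).symm
    have hyz' : ℋ.s (β.act x.1.2 y.1.1 hk) = ℋ.r (β.act x.1.2 (β.act y.1.2 z.1.1 hl) hl') := by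
      rw [hβ.s_act, hβ.r_act]
      exact β.act_congr rfl hyz _ _
    have hm : 𝒢.s x.1.2 = β.ρ (ℋ.mul y.1.1 (β.act y.1.2 z.1.1 hl) hyz) :=
      hk.trans (hβ.ρ_mul _ _ _).symm
    ext
    · refine Eq.trans ?_ ((ℋ.mul_assoc x.1.1 (β.act x.1.2 y.1.1 hk)
        (β.act x.1.2 (β.act y.1.2 z.1.1 hl) hl') hxy hyz').trans ?_)
      · exact ℋ.mul_congr rfl (β.mul_act _ _ _ hx hl) _ _
      · exact ℋ.mul_congr rfl
          (hβ.act_mul x.1.2 y.1.1 (β.act y.1.2 z.1.1 hl) hyz hm hk hl' hyz').symm _ _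
    · exact 𝒢.mul_assoc _ _ _ hx hy
  r_unit_mul z := by
    have hz : 𝒢.s (𝒢.r z.1.2) = β.ρ z.1.1 := (𝒢.s_r _).trans z.2.symm
    ext
    · refine (ℋ.mul_congr rfl (β.act_of_unit (𝒢.r_r _) hz) _ (ℋ.s_r _)).trans ?_
      exact ℋ.r_unit_mul _
    · exact 𝒢.r_unit_mul _
  mul_s_unit z := by
    have hz : 𝒢.s (𝒢.inv z.1.2) = β.ρ (ℋ.s z.1.1) :=
      (𝒢.s_inv _).trans (z.2.symm.trans (hβ.ρ_s _).symm)
    ext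
    · refine (ℋ.mul_congr rfl (β.act_inv_act hz) _ (ℋ.r_s _).symm).trans ?_
      exact ℋ.mul_s_unit _
    · exact 𝒢.mul_s_unit _
  r_inv z := by
    ext
    · exact (hβ.r_act _ _ _).trans (β.act_congr rfl (ℋ.r_inv _) _ _)
    · exact 𝒢.r_inv _
  s_inv z := by
    have hz : 𝒢.s (𝒢.inv z.1.2) = β.ρ (ℋ.inv z.1.1) :=
      (𝒢.s_inv _).trans (z.2.symm.trans (hβ.ρ_inv _).symm)
    have hz' : 𝒢.s (𝒢.inv z.1.2) = β.ρ (ℋ.s (ℋ.inv z.1.1)) := hz.trans (hβ.ρ_s _).symm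
    ext
    · refine (β.act_congr rfl (hβ.s_act _ _ hz) _
        ((𝒢.s_inv _).trans (β.ρ_act _ _ hz').symm)).trans ?_
      exact (β.inv_act_act hz').trans (ℋ.s_inv _)
    · exact 𝒢.s_inv _
  mul_inv z := by
    have hz : 𝒢.s (𝒢.inv z.1.2) = β.ρ (ℋ.inv z.1.1) :=
      (𝒢.s_inv _).trans (z.2.symm.trans (hβ.ρ_inv _).symm)
    ext
    · refine (ℋ.mul_congr rfl (β.act_inv_act hz) _ (ℋ.r_inv _).symm).trans ?_
      exact ℋ.mul_inv _
    · exact 𝒢.mul_inv _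
  inv_mul z := by
    have hz : 𝒢.s (𝒢.inv z.1.2) = β.ρ z.1.1 := (𝒢.s_inv _).trans z.2.symm
    have hi : 𝒢.s (𝒢.inv z.1.2) = β.ρ (ℋ.inv z.1.1) := hz.trans (hβ.ρ_inv _).symm
    ext
    · refine (hβ.act_mul _ _ _ (ℋ.s_inv _) (hi.trans (hβ.ρ_mul _ _ _).symm) hi hz _).symm.trans ?_
      exact β.act_congr rfl (ℋ.inv_mul _) _ _
    · exact 𝒢.inv_mul _

/-- The left action of `ℋ ⋊ 𝒢` on the arrows of `ℋ`: `(h, x) · k = h (x · k)`, with moment map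
`k ↦ (r k, ρ k)`. -/
def semidirectTranslation {β : LeftAction 𝒢 H} (hβ : β.ByIsomorphisms ℋ) :
    LeftAction hβ.semidirect H where
  ρ k := ⟨(ℋ.r k, β.ρ k), by
    change β.ρ (ℋ.r k) = 𝒢.r (β.ρ k)
    rw [hβ.ρ_r, β.ρ_unit]⟩
  ρ_unit k := by
    ext
    · exact ℋ.r_r _
    · exact β.ρ_unit _
  act z k e := ℋ.mul z.1.1 (β.act z.1.2 k (congrArg (fun a : hβ.Arrows => a.1.2) e))
    (hβ.composable _ (congrArg (fun a : hβ.Arrows => a.1.1) e) _)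
  ρ_act z k e := by
    ext
    · exact ℋ.r_mul _ _ _
    · exact (hβ.ρ_mul _ _ _).trans z.2
  unit_act k := by
    refine (ℋ.mul_congr rfl (β.act_of_unit (β.ρ_unit k) (𝒢.s_unit (β.ρ_unit k))) _
      (ℋ.s_r k)).trans ?_
    exact ℋ.r_unit_mul _
  mul_act x y k e₁ e₂ := by
    have hx : 𝒢.s x.1.2 = 𝒢.r y.1.2 := congrArg (fun a : hβ.Arrows => a.1.2) e₁
    have hl : 𝒢.s y.1.2 = β.ρ k := congrArg (fun a : hβ.Arrows => a.1.2) e₂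
    have hk : 𝒢.s x.1.2 = β.ρ y.1.1 := hx.trans y.2.symm
    have hyz : ℋ.s y.1.1 = ℋ.r (β.act y.1.2 k hl) :=
      hβ.composable _ (congrArg (fun a : hβ.Arrows => a.1.1) e₂) _
    have hxy : ℋ.s x.1.1 = ℋ.r (β.act x.1.2 y.1.1 hk) :=
      hβ.composable _ (congrArg (fun a : hβ.Arrows => a.1.1) e₁) _
    have hl' : 𝒢.s x.1.2 = β.ρ (β.act y.1.2 k hl) := hx.trans (β.ρ_act _ _ _).symm
    have hyz' : ℋ.s (β.act x.1.2 y.1.1 hk) = ℋ.r (β.act x.1.2 (β.act y.1.2 k hl) hl') := by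
      rw [hβ.s_act, hβ.r_act]
      exact β.act_congr rfl hyz _ _
    have hm : 𝒢.s x.1.2 = β.ρ (ℋ.mul y.1.1 (β.act y.1.2 k hl) hyz) :=
      hk.trans (hβ.ρ_mul _ _ _).symm
    refine Eq.trans ?_ ((ℋ.mul_assoc x.1.1 (β.act x.1.2 y.1.1 hk)
      (β.act x.1.2 (β.act y.1.2 k hl) hl') hxy hyz').trans ?_)
    · exact ℋ.mul_congr rfl (β.mul_act _ _ _ hx hl) _ _
    · exact ℋ.mul_congr rfl
        (hβ.act_mul x.1.2 y.1.1 (β.act y.1.2 k hl) hyz hm hk hl' hyz').symm _ _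

end LeftAction.ByIsomorphisms

/-- The data of an action of `𝒢` on a Fell bundle over `ℋ`, covering the action `β` of `𝒢` on `ℋ`:
`a ↦ x · a` maps the fibre over `h` to the fibre over `x · h`. -/
structure FellAction (β : LeftAction 𝒢 H) (A : FellBundle ℋ) where
  act : ∀ (x : G) {h : H} (hx : 𝒢.s x = β.ρ h), A.Fib h → A.Fib (β.act x h hx)

/-- The laws of a (continuous) action of `𝒢` on a Fell bundle by isomorphisms. -/
structure FellAction.IsByIsomorphisms [TopologicalSpace G] [TopologicalSpace H]
    {β : LeftAction 𝒢 H} {A : FellBundle ℋ} (Φ : FellAction β A) : Prop where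
  base_continuous : β.IsContinuous
  base : β.ByIsomorphisms ℋ
  continuous_act : Continuous fun z : {z : G × Tot A.Fib // 𝒢.s z.1 = β.ρ z.2.base} =>
    (⟨_, Φ.act z.1.1 z.2 z.1.2.val⟩ : Tot A.Fib)
  unit_act : ∀ {h} (a : A.Fib h),
    (⟨_, Φ.act (β.ρ h) (𝒢.s_unit (β.ρ_unit h)) a⟩ : Tot A.Fib) = ⟨_, a⟩
  mul_act : ∀ {x y h} (e : 𝒢.s x = 𝒢.r y) (e' : 𝒢.s y = β.ρ h) (a : A.Fib h),
    (⟨_, Φ.act (𝒢.mul x y e) ((𝒢.s_mul x y e).trans e') a⟩ : Tot A.Fib) =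
      ⟨_, Φ.act x (e.trans (β.ρ_act y h e').symm) (Φ.act y e' a)⟩
  act_add : ∀ {x h} (hx : 𝒢.s x = β.ρ h) (a b : A.Fib h),
    Φ.act x hx (a + b) = Φ.act x hx a + Φ.act x hx b
  act_smul : ∀ {x h} (hx : 𝒢.s x = β.ρ h) (z : ℂ) (a : A.Fib h),
    Φ.act x hx (z • a) = z • Φ.act x hx a
  norm_act : ∀ {x h} (hx : 𝒢.s x = β.ρ h) (a : A.Fib h), ‖Φ.act x hx a‖ = ‖a‖
  act_fell_mul : ∀ {x h k} (e : ℋ.s h = ℋ.r k) (hh : 𝒢.s x = β.ρ h) (hk : 𝒢.s x = β.ρ k),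
    ∃ (hm : 𝒢.s x = β.ρ (ℋ.mul h k e)) (e' : ℋ.s (β.act x h hh) = ℋ.r (β.act x k hk)),
    ∀ (a : A.Fib h) (b : A.Fib k),
    (⟨_, Φ.act x hm (A.mul e a b)⟩ : Tot A.Fib) = ⟨_, A.mul e' (Φ.act x hh a) (Φ.act x hk b)⟩
  act_fell_star : ∀ {x h} (hx : 𝒢.s x = β.ρ h),
    ∃ hi : 𝒢.s x = β.ρ (ℋ.inv h), ∀ a : A.Fib h,
    (⟨_, Φ.act x hi (A.star a)⟩ : Tot A.Fib) = ⟨_, A.star (Φ.act x hx a)⟩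

/-- The semidirect product Fell bundle `A ⋊ 𝒢` over `ℋ ⋊ 𝒢`: the fibre over `(h, x)` is `A(h)`, with
`(a, x) (b, y) = (a (x · b), x y)` and `(a, x)* = (x⁻¹ · a*, x⁻¹)`. -/
def FellAction.semidirect [TopologicalSpace G] [TopologicalSpace H] {β : LeftAction 𝒢 H}
    {A : FellBundle ℋ} (Φ : FellAction β A) (hβ : β.ByIsomorphisms ℋ) :
    FellBundle hβ.semidirect where
  toNBundle := A.toNBundle.pullback fun z : hβ.Arrows => z.1.1
  mul {z w} e a b := A.mul (x := z.1.1)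
    (hβ.composable _ (congrArg (fun a : hβ.Arrows => a.1.1) e) _) a
    (Φ.act z.1.2 (h := w.1.1) ((congrArg (fun a : hβ.Arrows => a.1.2) e).trans w.2.symm) b)
  star {z} a := Φ.act (𝒢.inv z.1.2) ((𝒢.s_inv _).trans (z.2.symm.trans (hβ.ρ_inv _).symm))
    (A.star (x := z.1.1) a)

end Semidirect

/-! ### Commuting actions -/

section Commuting

variable {G K T : Type*} {𝒢 : Gpd G} {𝒦 : Gpd K}

/-- The actions of `𝒦` and `𝒢` on `T` commute. -/
structure LeftAction.Commuting (α : LeftAction 𝒦 T) (β : LeftAction 𝒢 T) : Prop where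
  ρ_act : ∀ x t h, α.ρ (β.act x t h) = α.ρ t
  ρ_act' : ∀ k t h, β.ρ (α.act k t h) = β.ρ t
  comm : ∀ k x t (hk : 𝒦.s k = α.ρ t) (hx : 𝒢.s x = β.ρ t),
    α.act k (β.act x t hx) (hk.trans (ρ_act x t hx).symm) =
      β.act x (α.act k t hk) (hx.trans (ρ_act' k t hk).symm)

namespace LeftAction.Commuting

/-- The action `x · (k, t) = (k, x · t)` of `𝒢` on the action groupoid of `𝒦` on `T`. -/
def onArrows {α : LeftAction 𝒦 T} {β : LeftAction 𝒢 T} (hc : α.Commuting β) :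
    LeftAction 𝒢 α.Arrows where
  ρ z := β.ρ z.1.2
  ρ_unit z := β.ρ_unit _
  act x z h := ⟨(z.1.1, β.act x z.1.2 h), z.2.trans (hc.ρ_act _ _ _).symm⟩
  ρ_act x z h := β.ρ_act _ _ _
  unit_act z := by
    ext
    · rfl
    · exact β.unit_act _
  mul_act x y z h h' := by
    ext
    · rfl
    · exact β.mul_act _ _ _ _ _

theorem byIsomorphisms {α : LeftAction 𝒦 T} {β : LeftAction 𝒢 T} (hc : α.Commuting β) :
    hc.onArrows.ByIsomorphisms α.groupoid where
  ρ_r z := hc.ρ_act' _ _ _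
  ρ_s z := rfl
  r_act x z hx := by
    ext
    · rfl
    · exact hc.comm _ _ _ _ _
  s_act x z hx := rfl
  act_mul x z w e hx hh hk e' := rfl

variable [TopologicalSpace K] [TopologicalSpace T]

/-- The action `x · (b, t) = (b, x · t)` of `𝒢` on the action Fell bundle of `𝒦` on `T`. -/
def onFellBundle {α : LeftAction 𝒦 T} {β : LeftAction 𝒢 T} (hc : α.Commuting β)
    (B : FellBundle 𝒦) : FellAction hc.onArrows (α.fellBundle B) where
  act _ z _ b := (show B.Fib z.1.1 from b)

/-- The equivalence data on the action groupoid `𝒦 ⋉ T` between `(𝒦 ⋉ T) ⋊ 𝒢` and `𝒦`. Here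
`τ t t'` is an element of `𝒢` with `τ t t' · t' = t`. The translation maps are
`τl (k, t) (l, t') = ((k l⁻¹, x · l · t'), x)` with `x = τ t t'`, and `τr (k, t) (l, t') = k⁻¹ l`. -/
def gpdEquiv {α : LeftAction 𝒦 T} {β : LeftAction 𝒢 T} (hc : α.Commuting β)
    (τ : (t t' : T) → α.ρ t = α.ρ t' → G) (hτ : ∀ t t' h, 𝒢.s (τ t t' h) = β.ρ t') :
    GpdEquiv hc.byIsomorphisms.semidirect 𝒦 α.Arrows where
  left := hc.byIsomorphisms.semidirectTranslation
  right := α.rightOnArrows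
  τl z w h := ⟨(⟨(𝒦.mul z.1.1 (𝒦.inv w.1.1) (Eq.trans h (𝒦.r_inv _).symm),
      β.act (τ z.1.2 w.1.2 (z.2.symm.trans (Eq.trans h w.2))) (α.act w.1.1 w.1.2 w.2)
        ((hτ _ _ _).trans (hc.ρ_act' _ _ _).symm)), by
          change 𝒦.s (𝒦.mul _ _ _) = α.ρ (β.act _ _ _)
          rw [𝒦.s_mul, hc.ρ_act, α.ρ_act, 𝒦.s_inv]⟩,
      τ z.1.2 w.1.2 (z.2.symm.trans (Eq.trans h w.2))), β.ρ_act _ _ _⟩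
  τr z w h := 𝒦.mul (𝒦.inv z.1.1) w.1.1 ((𝒦.s_inv _).trans
    (congrArg (fun a : hc.byIsomorphisms.Arrows => a.1.1.1.1) h))

/-- The equivalence data on the action Fell bundle `B ⋉ T` between `(B ⋉ T) ⋊ 𝒢` and `B`:
`(b, t, x) · (c, t') = (b c, x · t')`, `(b, t) · c = (b c, p(c)⁻¹ · t)`,
`⟪(b, t), (c, t')⟫ = (b c*, x · p(c) · t', x)` with `x = τ t t'` on the left, and
`⟪(b, t), (c, t')⟫ = b* c` on the right. -/
def fellEquiv [TopologicalSpace G] {α : LeftAction 𝒦 T} {β : LeftAction 𝒢 T}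
    (hc : α.Commuting β)
    (τ : (t t' : T) → α.ρ t = α.ρ t' → G) (hτ : ∀ t t' h, 𝒢.s (τ t t' h) = β.ρ t')
    (B : FellBundle 𝒦) :
    FellEquiv (hc.gpdEquiv τ hτ) ((hc.onFellBundle B).semidirect hc.byIsomorphisms) B
      (α.fellBundle B).toNBundle where
  lact {z w} h b c := B.mul (x := z.1.1.1.1) (y := w.1.1)
    (congrArg (fun a : α.Arrows => a.1.1)
      (hc.byIsomorphisms.composable _
        (congrArg (fun a : hc.byIsomorphisms.Arrows => a.1.1) h)
        (congrArg (fun a : hc.byIsomorphisms.Arrows => a.1.2) h))) b c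
  ract {z l} h b c := B.mul (x := z.1.1) (y := l) h b c
  lip {z w} h b c := B.mul (x := z.1.1) (Eq.trans h (𝒦.r_inv _).symm) b (B.star (x := w.1.1) c)
  rip {z w} h b c := B.mul (y := w.1.1) ((𝒦.s_inv _).trans
    (congrArg (fun a : hc.byIsomorphisms.Arrows => a.1.1.1.1) h)) (B.star (x := z.1.1) b) c

end LeftAction.Commuting

end Commuting

/-! ### The two actions of a groupoid on itself -/

namespace Gpd

variable {G : Type*} (𝒢 : Gpd G)

/-- Left translation `x · y = x y`, with moment map `r`. -/
def leftTranslation : LeftAction 𝒢 G where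
  ρ := 𝒢.r
  ρ_unit := 𝒢.r_r
  act := 𝒢.mul
  ρ_act := 𝒢.r_mul
  unit_act := 𝒢.r_unit_mul
  mul_act := 𝒢.mul_assoc

/-- The action `x · y = y x⁻¹`, with moment map `s`. -/
def inverseTranslation : LeftAction 𝒢 G where
  ρ := 𝒢.s
  ρ_unit := 𝒢.r_s
  act x y h := 𝒢.mul y (𝒢.inv x) (h.symm.trans (𝒢.r_inv x).symm)
  ρ_act x y h := (𝒢.s_mul _ _ _).trans (𝒢.s_inv _)
  unit_act y := (𝒢.mul_congr rfl (𝒢.inv_unit (𝒢.r_s y)) _ (𝒢.r_s y).symm).trans (𝒢.mul_s_unit y)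
  mul_act x y z h h' := by
    have h₁ : 𝒢.s z = 𝒢.r (𝒢.inv y) := h'.symm.trans (𝒢.r_inv y).symm
    have h₂ : 𝒢.s (𝒢.inv y) = 𝒢.r (𝒢.inv x) := (𝒢.s_inv y).trans (h.symm.trans (𝒢.r_inv x).symm)
    exact (𝒢.mul_congr rfl (𝒢.inv_of_mul h) _ (h₁.trans (𝒢.r_mul _ _ h₂).symm)).trans
      (𝒢.mul_assoc z _ _ h₁ h₂).symm

theorem translations_commute : 𝒢.leftTranslation.Commuting 𝒢.inverseTranslation where
  ρ_act _ _ _ := 𝒢.r_mul _ _ _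
  ρ_act' _ _ _ := 𝒢.s_mul _ _ _
  comm _ _ _ _ _ := (𝒢.mul_assoc _ _ _ _ _).symm

/-- The element `t⁻¹ t'`, which carries `t'` to `t` under the action `x · y = y x⁻¹`. -/
def translation (t t' : G) (h : 𝒢.r t = 𝒢.r t') : G :=
  𝒢.mul (𝒢.inv t) t' ((𝒢.s_inv t).trans h)

theorem s_translation (t t' : G) (h : 𝒢.r t = 𝒢.r t') :
    𝒢.s (𝒢.translation t t' h) = 𝒢.inverseTranslation.ρ t' :=
  𝒢.s_mul _ _ _

end Gpd

/-! ### Norm estimates -/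

/-! Every bundle in the theorem is a pullback of `B`. The fibre over `(k, t)` of the action bundle
and the fibre over `((k, t), x)` of the semidirect product are both `B(k)`, and the maps to `k` are
groupoid homomorphisms. The second action is the identity on fibres, so the twist in the semidirect
product only affects base points. Hence each operation is, on fibres, the multiplication of `B`
combined with its involution, and each law splits into a law of `B` and an identity between base
points (`Tot.pullback_ext`). Continuity splits in the same way (`NBundle.continuous_pullback_iff`).
For instance, compatibility of the two inner products is `(b c*) d = b (c* d)`, and the fibre over
`(k, t)` is an imprimitivity bimodule because `B(k)` is one.

Two things do not come for free. The first is the inequality `‖a b‖ ≤ ‖a‖ ‖b‖` between arbitrary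
fibres of a Fell bundle, which bounds the two actions. It is not an axiom here, and
`FellBundle.IsFell.norm_mul_le` derives it from the bimodule structure of the fibres by the
Cauchy–Schwarz inequality.

The second is the equivalence of groupoids, `isEquivalence_gpdEquiv`. It is proved for commuting
actions of `𝒦` and `𝒢` on a space `T` when `𝒢` acts freely, its orbits are the fibres of the moment
map of `𝒦`, and it has a continuous translation map `τ`. Then the translation maps of both actions
on the arrows are explicit and continuous. They identify the orbits with the fibres of the moment
maps and, together with freeness, give properness (`IsFree.isProper`). Openness of the moment maps
rests on openness of the range map, which is where the Haar system enters. For a groupoid acting on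
itself, `τ t t' = t⁻¹ t'`. -/

theorem NBundle.norm_cast {X : Type*} (E : NBundle X) {x y : X} (h : x = y) (a : E.Fib x) :
    ‖E.cast h a‖ = ‖a‖ := by
  subst h; rfl

theorem NBundle.tot_cast {X : Type*} (E : NBundle X) {x y : X} (h : x = y) (a : E.Fib x) :
    (⟨y, E.cast h a⟩ : Tot E.Fib) = ⟨x, a⟩ := by
  subst h; rfl

theorem NBundle.norm_eq_of_tot_eq {X : Type*} (E : NBundle X) {a b : Tot E.Fib} (h : a = b) :
    ‖a.val‖ = ‖b.val‖ := by
  rw [h]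

/-- The C*-algebra structure given by a C*-multiplication and a C*-involution. -/
@[reducible] def IsCStar.nonUnitalCStarAlgebra {A : Type*} [N : NormedAddCommGroup A]
    [S : NormedSpace ℂ A] {m : A → A → A} {st : A → A} (h : IsCStar m st) :
    NonUnitalCStarAlgebra A :=
  have hz : m 0 = fun _ => 0 := by
    funext a
    simpa using h.smul_mul 0 0 a
  have hz' (a : A) : m a 0 = 0 := by simpa using h.mul_smul 0 a 0
  { N, S with
    complete := h.complete.complete
    mul := m
    left_distrib := h.mul_add
    right_distrib := h.add_mul
    zero_mul := fun a => congrFun hz a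
    mul_zero := hz'
    mul_assoc := h.mul_assoc
    norm_mul_le := h.norm_mul_le
    star := st
    star_involutive := h.star_star
    star_mul := h.star_mul
    star_add := h.star_add
    norm_mul_self_le := fun a => by
      have e : ‖m (st a) a‖ = ‖a‖ ^ 2 := h.norm_star_mul_self a
      exact (pow_two ‖a‖).symm.le.trans e.symm.le
    smul_assoc := h.smul_mul
    smul_comm := fun z a b => (h.mul_smul z a b).symm
    star_smul := h.star_smul }

theorem IsCStar.norm_star {A : Type*} [NormedAddCommGroup A] [NormedSpace ℂ A]
    {m : A → A → A} {st : A → A} (h : IsCStar m st) (a : A) : ‖st a‖ = ‖a‖ :=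
  letI := h.nonUnitalCStarAlgebra
  _root_.norm_star a

namespace IsImprimitivityBimodule

variable {A B E : Type*}
  [NormedAddCommGroup A] [NormedSpace ℂ A] [NormedAddCommGroup B] [NormedSpace ℂ B]
  [NormedAddCommGroup E] [NormedSpace ℂ E]
  {mA : A → A → A} {sA : A → A} {mB : B → B → B} {sB : B → B}
  {lact : A → E → E} {ract : E → B → E} {lip : E → E → A} {rip : E → E → B}

/-- This is the Cauchy–Schwarz inequality for Hilbert modules, obtained by presenting `E` as a
`CStarModule` over `A` with its spectral order. -/
theorem norm_lip_le (h : IsImprimitivityBimodule mA sA mB sB lact ract lip rip) (e f : E) :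
    ‖lip e f‖ ≤ ‖e‖ * ‖f‖ := by
  let := h.left_cstar.nonUnitalCStarAlgebra
  let := CStarAlgebra.spectralOrder A
  have := CStarAlgebra.spectralOrderedRing A
  let : SMul A E := ⟨lact⟩
  let : CStarModule A E :=
    -- The arguments are exchanged because `lip` is linear in its first variable and `inner` in its
    -- second.
    { inner := fun x y => lip y x
      inner_add_right := h.lip_add_left _ _ _
      inner_self_nonneg := by
        intro x
        obtain ⟨a, ha⟩ := h.lip_pos x
        exact ha ▸ star_mul_self_nonneg a
      inner_self := by
        intro x
        have e : ‖lip x x‖ = ‖x‖ ^ 2 := h.norm_lip x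
        constructor
        · intro hx
          have hx' : lip x x = 0 := hx
          rw [hx', norm_zero] at e
          simpa using e.symm
        · rintro rfl
          simpa using h.lip_smul_left 0 0 0
      inner_op_smul_right := h.lip_lact _ _ _
      inner_smul_right_complex := h.lip_smul_left _ _ _
      star_inner := fun x y => h.lip_star y x
      norm_eq_sqrt_norm_inner_self := fun x => by
        have e : ‖lip x x‖ = ‖x‖ ^ 2 := h.norm_lip x
        exact (Real.sqrt_sq (norm_nonneg x)).symm.trans (congrArg Real.sqrt e.symm) }
  rw [mul_comm]
  exact CStarModule.norm_inner_le (A := A) E (x := f) (y := e)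

/-- The square of the left side is the norm of `⟪e b, e b⟫ = b* ⟪e, e⟫ b`, and the C*-norm of `B` is
submultiplicative and invariant under the involution. -/
theorem norm_ract_le (h : IsImprimitivityBimodule mA sA mB sB lact ract lip rip) (e : E) (b : B) :
    ‖ract e b‖ ≤ ‖e‖ * ‖b‖ := by
  have h₁ : rip (ract e b) (ract e b) = mB (mB (sB b) (rip e e)) b := by
    rw [h.rip_ract, ← h.rip_star e (ract e b), h.rip_ract, h.right_cstar.star_mul, h.rip_star]
  have h₂ : ‖ract e b‖ ^ 2 ≤ (‖e‖ * ‖b‖) ^ 2 := by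
    rw [← h.norm_rip, h₁]
    calc _ ≤ ‖sB b‖ * ‖rip e e‖ * ‖b‖ := (h.right_cstar.norm_mul_le _ _).trans
          (mul_le_mul_of_nonneg_right (h.right_cstar.norm_mul_le _ _) (norm_nonneg _))
      _ = _ := by rw [h.right_cstar.norm_star, h.norm_rip]; ring
  exact le_of_sq_le_sq h₂ (by positivity)

end IsImprimitivityBimodule

/-! ### Submultiplicativity of the norm of a Fell bundle -/

namespace FellBundle

variable {G : Type*} {𝒢 : Gpd G} (A : FellBundle 𝒢)

theorem tot_mul_congr {x x' y y' : G} {a : A.Fib x} {a' : A.Fib x'} {b : A.Fib y} {b' : A.Fib y'}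
    (ha : (⟨x, a⟩ : Tot A.Fib) = ⟨x', a'⟩) (hb : (⟨y, b⟩ : Tot A.Fib) = ⟨y', b'⟩)
    (h : 𝒢.s x = 𝒢.r y) (h' : 𝒢.s x' = 𝒢.r y') :
    (⟨_, A.mul h a b⟩ : Tot A.Fib) = ⟨_, A.mul h' a' b'⟩ := by
  cases ha; cases hb; rfl

variable {A} [TopologicalSpace G] (hA : A.IsFell)
include hA

theorem IsFell.norm_mul_star_self {x : G} (a : A.Fib x) :
    ‖A.mul (𝒢.r_inv x).symm a (A.star a)‖ = ‖a‖ ^ 2 := by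
  rw [← (hA.imprimitivity x).norm_lip, A.norm_cast]

theorem IsFell.norm_mul_star_le {x : G} (a b : A.Fib x) :
    ‖A.mul (𝒢.r_inv x).symm a (A.star b)‖ ≤ ‖a‖ * ‖b‖ := by
  have := (hA.imprimitivity x).norm_lip_le a b
  rwa [A.norm_cast] at this

/-- The unit `u` is kept general, although it must equal `s x`, because it will be the product `y
y⁻¹`. -/
theorem IsFell.norm_mul_unit_le {x u : G} (hu : 𝒢.r u = u) (h : 𝒢.s x = 𝒢.r u)
    (a : A.Fib x) (b : A.Fib u) : ‖A.mul h a b‖ ≤ ‖a‖ * ‖b‖ := by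
  obtain rfl : 𝒢.s x = u := h.trans hu
  have := (hA.imprimitivity x).norm_ract_le a b
  rwa [A.norm_cast] at this

/-- Since `(a b)(a b)* = (a (b b*)) a*` and `b b*` lies over a unit, Cauchy–Schwarz in the fibre of
`a` and the bound for the right action of a unit fibre give `‖a b‖² ≤ ‖a‖ ‖b b*‖ ‖a‖ = ‖a‖² ‖b‖²`.
-/
theorem IsFell.norm_mul_le {x y : G} (h : 𝒢.s x = 𝒢.r y) (a : A.Fib x) (b : A.Fib y) :
    ‖A.mul h a b‖ ≤ ‖a‖ * ‖b‖ := by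
  have hy : 𝒢.s y = 𝒢.r (𝒢.inv y) := (𝒢.r_inv y).symm
  have hyx : 𝒢.s (𝒢.inv y) = 𝒢.r (𝒢.inv x) :=
    (𝒢.s_inv y).trans (h.symm.trans (𝒢.r_inv x).symm)
  have hu : 𝒢.r (𝒢.mul y (𝒢.inv y) hy) = 𝒢.mul y (𝒢.inv y) hy := by
    rw [𝒢.mul_inv, 𝒢.r_r]
  have hxu : 𝒢.s x = 𝒢.r (𝒢.mul y (𝒢.inv y) hy) := h.trans (𝒢.r_mul _ _ _).symm
  have hx : 𝒢.mul x _ hxu = x := 𝒢.mul_unit hu hxu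
  set d := A.mul hy b (A.star b)
  -- The product `a d` lies over `x (y y⁻¹)`. It is transported to the fibre over `x` so that
  -- Cauchy–Schwarz applies to it and `a`.
  have key : (⟨_, A.mul (𝒢.r_inv _).symm (A.mul h a b) (A.star (A.mul h a b))⟩ : Tot A.Fib) =
      ⟨_, A.mul (𝒢.r_inv x).symm (A.cast hx (A.mul hxu a d)) (A.star a)⟩ := by
    rw [A.tot_mul_congr rfl (hA.star_mul h a b) _
      ((𝒢.s_mul _ _ _).trans (hy.trans (𝒢.r_mul _ _ hyx).symm)),
      ← hA.mul_assoc ((𝒢.s_mul _ _ _).trans hy) hyx]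
    exact A.tot_mul_congr ((hA.mul_assoc h hy a b (A.star b)).trans (A.tot_cast hx _).symm) rfl _ _
  have h₂ : ‖A.mul h a b‖ ^ 2 ≤ (‖a‖ * ‖b‖) ^ 2 := by
    rw [← hA.norm_mul_star_self, A.norm_eq_of_tot_eq key]
    calc _ ≤ ‖A.cast hx (A.mul hxu a d)‖ * ‖a‖ := hA.norm_mul_star_le _ _
      _ ≤ ‖a‖ * ‖d‖ * ‖a‖ := by
        rw [A.norm_cast]
        exact mul_le_mul_of_nonneg_right (hA.norm_mul_unit_le hu hxu a d) (norm_nonneg _)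
      _ = _ := by rw [hA.norm_mul_star_self]; ring
  exact le_of_sq_le_sq h₂ (by positivity)

end FellBundle

/-! ### Pullbacks of bundles -/

/-- Equality in the total space of a pulled back bundle. -/
theorem Tot.pullback_ext {X Y : Type*} {F : Y → Type*} (f : X → Y) {x y : X} (h : x = y)
    {a : F (f x)} {b : F (f y)} (e : (⟨f x, a⟩ : Tot F) = ⟨f y, b⟩) :
    (⟨x, a⟩ : Tot fun x => F (f x)) = ⟨y, b⟩ := by
  subst h
  cases e
  rfl

namespace NBundle

variable {X Y : Type*} [TopologicalSpace X] (E : NBundle Y) (f : X → Y)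

theorem pullback_cast {x y : X} (h : x = y) (a : (E.pullback f).Fib x) :
    (E.pullback f).cast h a = E.cast (congrArg f h) a := by
  subst h; rfl

/-- The canonical map from the total space of a pullback. -/
def ofPullback (a : Tot (E.pullback f).Fib) : Tot E.Fib := ⟨f a.base, a.val⟩

theorem isInducing_pullback :
    IsInducing fun a : Tot (E.pullback f).Fib => (E.ofPullback f a, a.base) := ⟨rfl⟩

/-- Continuity of an operation on a pulled back bundle thus reduces to continuity of an operation on
the original bundle and of a structure map on the base. -/
theorem continuous_pullback_iff {Z : Type*} [TopologicalSpace Z]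
    {g : Z → Tot (E.pullback f).Fib} :
    Continuous g ↔ Continuous (fun z => E.ofPullback f (g z)) ∧ Continuous fun z => (g z).base :=
  (E.isInducing_pullback f).continuous_iff.trans continuous_prodMk

theorem continuous_ofPullback : Continuous (E.ofPullback f) :=
  ((E.continuous_pullback_iff f).1 continuous_id).1

theorem continuous_base_pullback : Continuous fun a : Tot (E.pullback f).Fib => a.base :=
  ((E.continuous_pullback_iff f).1 continuous_id).2

variable {E f}

theorem IsBanachBundle.pullback [TopologicalSpace Y] (hE : E.IsBanachBundle)
    (hf : Continuous f) : (E.pullback f).IsBanachBundle where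
  complete x := hE.complete (f x)
  continuous_proj := E.continuous_base_pullback f
  open_proj := by
    intro O hO
    obtain ⟨V, hV, rfl⟩ := (E.isInducing_pullback f).isOpen_iff.1 hO
    refine isOpen_iff_mem_nhds.2 ?_
    rintro _ ⟨a, ha, rfl⟩
    obtain ⟨U₁, U₂, hU₁, hU₂, ha₁, ha₂, hU⟩ := isOpen_prod_iff.1 hV _ _ ha
    -- This set lies in the image of the box `U₁ × U₂`: over a point `x` of it, some element of `U₁`
    -- lies over `f x`. It is open because the projection of `E` is open and `f` is continuous.
    have hW : IsOpen (U₂ ∩ f ⁻¹' ((fun b : Tot E.Fib => b.base) '' U₁)) :=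
      hU₂.inter ((hE.open_proj U₁ hU₁).preimage hf)
    refine mem_of_superset (hW.mem_nhds ⟨ha₂, E.ofPullback f a, ha₁, rfl⟩) ?_
    rintro x ⟨hx, b, hb, hbx⟩
    refine ⟨⟨x, E.cast hbx b.val⟩, hU ⟨?_, hx⟩, rfl⟩
    change (⟨f x, _⟩ : Tot E.Fib) ∈ U₁
    rw [E.tot_cast hbx b.val]
    exact hb
  usc_norm := fun a y hy => (E.continuous_ofPullback f).tendsto a (hE.usc_norm _ y hy)
  continuous_add := by
    have v₁ := continuous_fst.comp (continuous_subtype_val (p := fun z : Tot (E.pullback f).Fib ×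
      Tot (E.pullback f).Fib => z.1.base = z.2.base))
    have v₂ := continuous_snd.comp (continuous_subtype_val (p := fun z : Tot (E.pullback f).Fib ×
      Tot (E.pullback f).Fib => z.1.base = z.2.base))
    have h₀ := (E.continuous_base_pullback f).comp v₁
    refine (E.continuous_pullback_iff f).2 ⟨?_, h₀⟩
    have h₁ := (E.continuous_ofPullback f).comp v₁
    have h₂ := (E.continuous_ofPullback f).comp v₂
    refine (hE.continuous_add.comp ((h₁.prodMk h₂).subtype_mk fun z => congrArg f z.2)).congr ?_
    intro z
    refine congrArg (Tot.mk _) (congrArg (z.1.1.val + ·) ?_)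
    exact (E.pullback_cast f _ _).symm
  continuous_smul c := (E.continuous_pullback_iff f).2
    ⟨(hE.continuous_smul c).comp (E.continuous_ofPullback f), E.continuous_base_pullback f⟩
  tendsto_zero x l hl hl₀ := by
    rw [(E.isInducing_pullback f).nhds_eq_comap, ← map_le_iff_le_comap]
    refine Tendsto.prodMk_nhds (f := l) ?_ hl
    exact hE.tendsto_zero (f x) (map (E.ofPullback f) l)
      (tendsto_map'_iff.2 ((hf.tendsto x).comp hl)) (tendsto_map'_iff.2 hl₀)

end NBundle

/-! ### Action groupoids, semidirect products and their Fell bundles -/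

namespace LeftAction

variable {K T : Type*} {𝒦 : Gpd K} {α : LeftAction 𝒦 T} [TopologicalSpace K] [TopologicalSpace T]

theorem fellBundle_cast (B : FellBundle 𝒦) {z w : α.Arrows} (h : z = w)
    (a : (α.fellBundle B).Fib z) : (α.fellBundle B).cast h a =
      B.cast (congrArg (fun z : α.Arrows => z.1.1) h) a :=
  B.pullback_cast _ h a

section

variable [T2Space T] [LocallyCompactSpace T] [SecondCountableTopology T]

theorem isLocallyCompact_groupoid (h𝒦 : 𝒦.IsLocallyCompact) (hα : α.IsContinuous) :
    α.groupoid.IsLocallyCompact := by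
  have := h𝒦.t2
  have := h𝒦.locallyCompact
  have := h𝒦.secondCountable
  have hcl : IsClosed {z : K × T | 𝒦.s z.1 = α.ρ z.2} := isClosed_eq
    (h𝒦.continuous_s.comp continuous_fst) (hα.continuous_ρ.comp continuous_snd)
  have h₁ : Continuous fun z : α.Arrows => z.1.1 := continuous_fst.comp continuous_subtype_val
  have h₂ : Continuous fun z : α.Arrows => z.1.2 := continuous_snd.comp continuous_subtype_val
  have v₁ := continuous_fst.comp (continuous_subtype_val
    (p := fun z : α.Arrows × α.Arrows => α.groupoid.s z.1 = α.groupoid.r z.2))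
  have v₂ := continuous_snd.comp (continuous_subtype_val
    (p := fun z : α.Arrows × α.Arrows => α.groupoid.s z.1 = α.groupoid.r z.2))
  exact
  { t2 := inferInstance
    locallyCompact := hcl.isClosedEmbedding_subtypeVal.locallyCompactSpace
    secondCountable := IsEmbedding.subtypeVal.secondCountableTopology
    continuous_r := ((h𝒦.continuous_r.comp h₁).prodMk hα.continuous_act).subtype_mk _
    continuous_s := ((h𝒦.continuous_s.comp h₁).prodMk h₂).subtype_mk _
    continuous_inv := ((h𝒦.continuous_inv.comp h₁).prodMk hα.continuous_act).subtype_mk _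
    continuous_mul := ((h𝒦.continuous_mul.comp (((h₁.comp v₁).prodMk (h₁.comp v₂)).subtype_mk
      fun z => congrArg (fun a : α.Arrows => a.1.1) z.2)).prodMk (h₂.comp v₂)).subtype_mk _ }

/-- The operations on fibres are those of `B` and do not see `t`, so each axiom is the axiom of `B`
paired, where base points differ, with a law of the action groupoid. -/
theorem isFell_fellBundle (h𝒦 : 𝒦.IsLocallyCompact) {B : FellBundle 𝒦} (hB : B.IsFell)
    (hα : α.IsContinuous) :
    (α.fellBundle B).IsFell := by
  have hf : Continuous fun z : α.Arrows => z.1.1 := continuous_fst.comp continuous_subtype_val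
  have hb := B.continuous_base_pullback fun z : α.Arrows => z.1.1
  have hP := B.continuous_ofPullback fun z : α.Arrows => z.1.1
  -- Transports along equal arrows are transports in `B` along their first coordinates. Hence the
  -- unit fibres carry the very C*-operations of `B`.
  have hm {u : α.Arrows} (hu : α.groupoid.r u = u) : (α.fellBundle B).unitMul hu =
      B.unitMul (congrArg (fun z : α.Arrows => z.1.1) hu) := by
    funext a b
    exact fellBundle_cast B _ _
  have hs {u : α.Arrows} (hu : α.groupoid.r u = u) : (α.fellBundle B).unitStar hu =
      B.unitStar (congrArg (fun z : α.Arrows => z.1.1) hu) := by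
    funext a
    exact fellBundle_cast B _ _
  have hα₀ := isLocallyCompact_groupoid h𝒦 hα
  have v₁ := continuous_fst.comp (continuous_subtype_val
    (p := fun z : Tot (α.fellBundle B).Fib × Tot (α.fellBundle B).Fib =>
      α.groupoid.s z.1.base = α.groupoid.r z.2.base))
  have v₂ := continuous_snd.comp (continuous_subtype_val
    (p := fun z : Tot (α.fellBundle B).Fib × Tot (α.fellBundle B).Fib =>
      α.groupoid.s z.1.base = α.groupoid.r z.2.base))
  exact
  { banach := hB.banach.pullback hf
    continuous_mul := (B.continuous_pullback_iff _).2
      ⟨hB.continuous_mul.comp (((hP.comp v₁).prodMk (hP.comp v₂)).subtype_mk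
        fun z => congrArg (fun a : α.Arrows => a.1.1) z.2),
      hα₀.continuous_mul.comp (((hb.comp v₁).prodMk (hb.comp v₂)).subtype_mk fun z => z.2)⟩
    continuous_star := (B.continuous_pullback_iff _).2
      ⟨hB.continuous_star.comp hP, hα₀.continuous_inv.comp hb⟩
    add_mul := fun h a b c => hB.add_mul _ a b c
    mul_add := fun h a b c => hB.mul_add _ a b c
    smul_mul := fun h z a b => hB.smul_mul _ z a b
    mul_smul := fun h z a b => hB.mul_smul _ z a b
    mul_assoc := fun h₁ h₂ a b c => Tot.pullback_ext (fun z : α.Arrows => z.1.1)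
      (α.groupoid.mul_assoc _ _ _ h₁ h₂) (hB.mul_assoc _ _ a b c)
    star_add := fun a b => hB.star_add a b
    star_smul := fun z a => hB.star_smul z a
    star_star := fun a => Tot.pullback_ext (fun z : α.Arrows => z.1.1)
      (α.groupoid.inv_inv _) (hB.star_star a)
    star_mul := fun h a b => Tot.pullback_ext (fun z : α.Arrows => z.1.1)
      (α.groupoid.inv_of_mul h) (hB.star_mul _ a b)
    cstar := fun hu => by
      rw [hm, hs]
      exact hB.cstar _
    imprimitivity := fun x => by
      simp only [hm, hs, fellBundle_cast]
      exact hB.imprimitivity x.1.1 }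

end

end LeftAction

/-! ### Topology of semidirect product groupoids -/

section Semidirect

variable {G H : Type*} {𝒢 : Gpd G} {ℋ : Gpd H} [TopologicalSpace G] [TopologicalSpace H]
  {β : LeftAction 𝒢 H}

theorem LeftAction.ByIsomorphisms.isLocallyCompact_semidirect (hβ : β.ByIsomorphisms ℋ)
    (h𝒢 : 𝒢.IsLocallyCompact) (hℋ : ℋ.IsLocallyCompact) (hc : β.IsContinuous) :
    hβ.semidirect.IsLocallyCompact := by
  have := h𝒢.t2
  have := h𝒢.locallyCompact
  have := h𝒢.secondCountable
  have := hℋ.t2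
  have := hℋ.locallyCompact
  have := hℋ.secondCountable
  have hcl : IsClosed {z : H × G | β.ρ z.1 = 𝒢.r z.2} := isClosed_eq
    (hc.continuous_ρ.comp continuous_fst) (h𝒢.continuous_r.comp continuous_snd)
  have h₁ : Continuous fun z : hβ.Arrows => z.1.1 := continuous_fst.comp continuous_subtype_val
  have h₂ : Continuous fun z : hβ.Arrows => z.1.2 := continuous_snd.comp continuous_subtype_val
  have hi := h𝒢.continuous_inv.comp h₂
  have v₁ := continuous_fst.comp (continuous_subtype_val
    (p := fun z : hβ.Arrows × hβ.Arrows => hβ.semidirect.s z.1 = hβ.semidirect.r z.2))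
  have v₂ := continuous_snd.comp (continuous_subtype_val
    (p := fun z : hβ.Arrows × hβ.Arrows => hβ.semidirect.s z.1 = hβ.semidirect.r z.2))
  have ha := hc.continuous_act.comp (((h₂.comp v₁).prodMk (h₁.comp v₂)).subtype_mk
    fun z => (congrArg (fun a : hβ.Arrows => a.1.2) z.2).trans z.1.2.2.symm)
  exact
  { t2 := inferInstance
    locallyCompact := hcl.isClosedEmbedding_subtypeVal.locallyCompactSpace
    secondCountable := IsEmbedding.subtypeVal.secondCountableTopology
    continuous_r := ((hℋ.continuous_r.comp h₁).prodMk (h𝒢.continuous_r.comp h₂)).subtype_mk _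
    continuous_s := ((hc.continuous_act.comp ((hi.prodMk (hℋ.continuous_s.comp h₁)).subtype_mk
      fun z => (𝒢.s_inv _).trans (z.2.symm.trans (hβ.ρ_s _).symm))).prodMk
        (h𝒢.continuous_s.comp h₂)).subtype_mk _
    continuous_inv := ((hc.continuous_act.comp ((hi.prodMk (hℋ.continuous_inv.comp h₁)).subtype_mk
      fun z => (𝒢.s_inv _).trans (z.2.symm.trans (hβ.ρ_inv _).symm))).prodMk hi).subtype_mk _
    continuous_mul := ((hℋ.continuous_mul.comp (((h₁.comp v₁).prodMk ha).subtype_mk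
      fun z => hβ.composable _ (congrArg (fun a : hβ.Arrows => a.1.1) z.2) _)).prodMk
        (h𝒢.continuous_mul.comp (((h₂.comp v₁).prodMk (h₂.comp v₂)).subtype_mk
          fun z => congrArg (fun a : hβ.Arrows => a.1.2) z.2))).subtype_mk _ }

end Semidirect

/-! ### Commuting actions: the induced action and its semidirect product bundle -/

namespace LeftAction.Commuting

variable {G K T : Type*} {𝒢 : Gpd G} {𝒦 : Gpd K} [TopologicalSpace G] [TopologicalSpace K]
  [TopologicalSpace T] {α : LeftAction 𝒦 T} {β : LeftAction 𝒢 T} (hc : α.Commuting β)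
  {B : FellBundle 𝒦}
include hc

theorem isContinuous_onArrows (hβ : β.IsContinuous) :
    hc.onArrows.IsContinuous := by
  have h₁ : Continuous fun z : α.Arrows => z.1.1 := continuous_fst.comp continuous_subtype_val
  have h₂ : Continuous fun z : α.Arrows => z.1.2 := continuous_snd.comp continuous_subtype_val
  have v₁ := continuous_fst.comp (continuous_subtype_val
    (p := fun z : G × α.Arrows => 𝒢.s z.1 = hc.onArrows.ρ z.2))
  have v₂ := continuous_snd.comp (continuous_subtype_val
    (p := fun z : G × α.Arrows => 𝒢.s z.1 = hc.onArrows.ρ z.2))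
  exact
  { continuous_ρ := hβ.continuous_ρ.comp h₂
    continuous_act := ((h₁.comp v₂).prodMk (hβ.continuous_act.comp
      ((v₁.prodMk (h₂.comp v₂)).subtype_mk fun z => z.2))).subtype_mk _ }

/-- The action is the identity on fibres, so only the laws of the action on base points have
content. -/
theorem isByIsomorphisms_onFellBundle (hβ : β.IsContinuous) :
    (hc.onFellBundle B).IsByIsomorphisms := by
  have hb := B.continuous_base_pullback fun z : α.Arrows => z.1.1
  have hP := B.continuous_ofPullback fun z : α.Arrows => z.1.1
  have v₁ := continuous_fst.comp (continuous_subtype_val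
    (p := fun z : G × Tot (α.fellBundle B).Fib => 𝒢.s z.1 = hc.onArrows.ρ z.2.base))
  have v₂ := continuous_snd.comp (continuous_subtype_val
    (p := fun z : G × Tot (α.fellBundle B).Fib => 𝒢.s z.1 = hc.onArrows.ρ z.2.base))
  have h₀ := hP.comp v₂
  exact
  { base_continuous := hc.isContinuous_onArrows hβ
    base := hc.byIsomorphisms
    continuous_act := (B.continuous_pullback_iff _).2 ⟨h₀,
      (hc.isContinuous_onArrows hβ).continuous_act.comp
        ((v₁.prodMk (hb.comp v₂)).subtype_mk fun z => z.2)⟩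
    unit_act := fun a => Tot.pullback_ext (fun z : α.Arrows => z.1.1) (hc.onArrows.unit_act _) rfl
    mul_act := fun e e' a => Tot.pullback_ext (fun z : α.Arrows => z.1.1)
      (hc.onArrows.mul_act _ _ _ e e') rfl
    act_add := fun _ _ _ => rfl
    act_smul := fun _ _ _ => rfl
    norm_act := fun _ _ => rfl
    act_fell_mul := fun {x h k} e hh hk => by
      have e' : α.groupoid.s (hc.onArrows.act x h hh) = α.groupoid.r (hc.onArrows.act x k hk) := by
        rw [hc.byIsomorphisms.s_act, hc.byIsomorphisms.r_act]
        exact hc.onArrows.act_congr rfl e _ _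
      exact ⟨hh.trans (hc.byIsomorphisms.ρ_mul h k e).symm, e', fun a b =>
        Tot.pullback_ext (fun z : α.Arrows => z.1.1)
          (hc.byIsomorphisms.act_mul x h k e _ hh hk e') rfl⟩
    act_fell_star := fun {x h} hx => ⟨hx.trans (hc.byIsomorphisms.ρ_inv h).symm, fun a =>
      Tot.pullback_ext (fun z : α.Arrows => z.1.1)
        (hc.byIsomorphisms.inv_act x h hx).symm rfl⟩ }

theorem semidirect_cast {z w : hc.byIsomorphisms.Arrows} (h : z = w)
    (a : ((hc.onFellBundle B).semidirect hc.byIsomorphisms).Fib z) :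
    ((hc.onFellBundle B).semidirect hc.byIsomorphisms).cast h a =
      B.cast (congrArg (fun z : hc.byIsomorphisms.Arrows => z.1.1.1.1) h) a := by
  subst h; rfl

/-- Because `𝒢` acts by the identity on fibres, the twisted product `a (x · b)` is the product of
`a` and `b` in `B`. The bundle is the pullback of `B` along the homomorphism `((k, t), x) ↦ k`, and
the axioms transfer as for the action bundle. -/
theorem isFell_semidirect (h𝒢 : 𝒢.IsLocallyCompact) (h𝒦 : 𝒦.IsLocallyCompact) [T2Space T]
    [LocallyCompactSpace T] [SecondCountableTopology T] (hα : α.IsContinuous)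
    (hβ : β.IsContinuous) (hB : B.IsFell) :
    ((hc.onFellBundle B).semidirect hc.byIsomorphisms).IsFell := by
  set A := (hc.onFellBundle B).semidirect hc.byIsomorphisms
  have h₁ : Continuous fun z : hc.byIsomorphisms.Arrows => z.1.1 :=
    continuous_fst.comp continuous_subtype_val
  have hE := isFell_fellBundle h𝒦 hB hα
  have hb := (α.fellBundle B).continuous_base_pullback fun z : hc.byIsomorphisms.Arrows => z.1.1
  have hP' := (α.fellBundle B).continuous_ofPullback fun z : hc.byIsomorphisms.Arrows => z.1.1
  have hP := (B.continuous_ofPullback fun z : α.Arrows => z.1.1).comp hP'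
  have hA₀ := hc.byIsomorphisms.isLocallyCompact_semidirect h𝒢 (isLocallyCompact_groupoid h𝒦 hα)
    (hc.isContinuous_onArrows hβ)
  -- The topology is that of an iterated pullback; the intermediate base point `(k, t)` depends
  -- continuously on the final one.
  have hcont {Z : Type _} [TopologicalSpace Z] {g : Z → Tot A.Fib} (hg : Continuous fun z =>
      (⟨(g z).base.1.1.1.1, (g z).val⟩ : Tot B.Fib)) (hg' : Continuous fun z => (g z).base) :
      Continuous g :=
    ((α.fellBundle B).continuous_pullback_iff _).2
      ⟨(B.continuous_pullback_iff _).2 ⟨hg, h₁.comp hg'⟩, hg'⟩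
  have hm {u : hc.byIsomorphisms.Arrows} (hu : hc.byIsomorphisms.semidirect.r u = u) :
      A.unitMul hu =
        B.unitMul (congrArg (fun z : hc.byIsomorphisms.Arrows => z.1.1.1.1) hu) := by
    funext a b
    exact hc.semidirect_cast _ _
  have hs {u : hc.byIsomorphisms.Arrows} (hu : hc.byIsomorphisms.semidirect.r u = u) :
      A.unitStar hu =
        B.unitStar (congrArg (fun z : hc.byIsomorphisms.Arrows => z.1.1.1.1) hu) := by
    funext a
    exact hc.semidirect_cast _ _
  have v₁ := continuous_fst.comp (continuous_subtype_val
    (p := fun z : Tot A.Fib × Tot A.Fib =>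
      hc.byIsomorphisms.semidirect.s z.1.base = hc.byIsomorphisms.semidirect.r z.2.base))
  have v₂ := continuous_snd.comp (continuous_subtype_val
    (p := fun z : Tot A.Fib × Tot A.Fib =>
      hc.byIsomorphisms.semidirect.s z.1.base = hc.byIsomorphisms.semidirect.r z.2.base))
  have hext {z w : hc.byIsomorphisms.Arrows} (h : z = w) {a : B.Fib z.1.1.1.1}
      {b : B.Fib w.1.1.1.1} (e : (⟨z.1.1.1.1, a⟩ : Tot B.Fib) = ⟨w.1.1.1.1, b⟩) :
      (⟨z, a⟩ : Tot A.Fib) = ⟨w, b⟩ :=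
    Tot.pullback_ext (F := B.Fib) (fun z : hc.byIsomorphisms.Arrows => z.1.1.1.1) h e
  have hcomp {z w : hc.byIsomorphisms.Arrows}
      (h : hc.byIsomorphisms.semidirect.s z = hc.byIsomorphisms.semidirect.r w) :
      𝒦.s z.1.1.1.1 = 𝒦.r w.1.1.1.1 :=
    congrArg (fun z : hc.byIsomorphisms.Arrows => z.1.1.1.1) h
  exact
  { banach := hE.banach.pullback h₁
    continuous_mul := hcont
      (hB.continuous_mul.comp (((hP.comp v₁).prodMk (hP.comp v₂)).subtype_mk fun z => hcomp z.2))
      (hA₀.continuous_mul.comp (((hb.comp v₁).prodMk (hb.comp v₂)).subtype_mk fun z => z.2))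
    continuous_star := hcont (hB.continuous_star.comp hP) (hA₀.continuous_inv.comp hb)
    add_mul := fun h a b c => hB.add_mul (hcomp h) a b c
    mul_add := fun h a b c => hB.mul_add (hcomp h) a b c
    smul_mul := fun h z a b => hB.smul_mul (hcomp h) z a b
    mul_smul := fun h z a b => hB.mul_smul (hcomp h) z a b
    mul_assoc := fun h₁ h₂ a b c => hext
      (hc.byIsomorphisms.semidirect.mul_assoc _ _ _ h₁ h₂)
      (hB.mul_assoc (hcomp h₁) (hcomp h₂) a b c)
    star_add := fun a b => hB.star_add a b
    star_smul := fun z a => hB.star_smul z a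
    star_star := fun a => hext (hc.byIsomorphisms.semidirect.inv_inv _) (hB.star_star a)
    star_mul := fun h a b => hext (hc.byIsomorphisms.semidirect.inv_of_mul h)
      (hB.star_mul (hcomp h) a b)
    cstar := fun hu => by
      rw [hm, hs]
      exact hB.cstar _
    imprimitivity := fun x => by
      simp only [hm, hs, A, hc.semidirect_cast]
      exact hB.imprimitivity x.1.1.1.1 }

end LeftAction.Commuting

/-! ### Open range maps and proper actions -/

namespace Gpd

variable {G : Type*} {𝒢 : Gpd G} [TopologicalSpace G]

/-- The range map of a groupoid with a Haar system is open. -/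
theorem HaarSystem.isOpenMap_r [MeasurableSpace G] [BorelSpace G] (h𝒢 : 𝒢.IsLocallyCompact)
    (haar : 𝒢.HaarSystem) : IsOpenMap fun x => (⟨𝒢.r x, 𝒢.r_r x⟩ : 𝒢.Units) := by
  have := h𝒢.t2
  have := h𝒢.locallyCompact
  have := h𝒢.secondCountable
  intro U hU
  refine isOpen_iff_mem_nhds.2 ?_
  rintro _ ⟨x, hx, rfl⟩
  obtain ⟨f, hf₁, hf₀, hfc, hf⟩ := exists_continuous_one_zero_of_isCompact (isCompact_singleton
    (x := x)) hU.isClosed_compl (by simpa using hx)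
  -- The bump function `f` is nonnegative, equals `1` at `x` and vanishes off `U`. Its integral is
  -- therefore positive exactly when `μ u` charges the set where `f` is nonzero.
  have hpos (u : 𝒢.Units) : 0 < ∫ y, f y ∂(haar.μ u) ↔ 0 < haar.μ u (Function.support f) := by
    have := haar.regular u
    exact integral_pos_iff_support_of_nonneg (fun y => (hf y).1)
      (f.continuous.integrable_of_hasCompactSupport hfc)
  have hx₀ : 0 < ∫ y, f y ∂(haar.μ ⟨𝒢.r x, 𝒢.r_r x⟩) := by
    rw [hpos]
    have hxs : x ∈ (haar.μ ⟨𝒢.r x, 𝒢.r_r x⟩).support := by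
      rw [haar.support_eq]
      rfl
    refine (Measure.mem_support_iff_forall x).1 hxs _ (f.continuous.isOpen_support.mem_nhds ?_)
    simp [hf₁ (Set.mem_singleton x)]
  -- The integral is positive at `r x`, hence at all nearby units `u`. Each such `u` is the range of
  -- a point of `U`: otherwise the set where `f` is nonzero would miss the support of `μ u` and be
  -- null.
  refine mem_of_superset ((haar.continuous_integral f f.continuous hfc).tendsto _
    (lt_mem_nhds hx₀)) fun u hu => ?_
  by_contra hne
  refine ((hpos u).1 hu).ne' (measure_mono_null ?_
    (Measure.measure_compl_support (μ := haar.μ u)))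
  intro y hy hys
  rw [haar.support_eq] at hys
  refine hne ⟨y, ?_, Subtype.ext hys⟩
  by_contra hyU
  exact hy (hf₀ hyU)

theorem IsLocallyCompact.isOpenMap_s (h𝒢 : 𝒢.IsLocallyCompact)
    (hr : IsOpenMap fun x => (⟨𝒢.r x, 𝒢.r_r x⟩ : 𝒢.Units)) :
    IsOpenMap fun x => (⟨𝒢.s x, 𝒢.r_s x⟩ : 𝒢.Units) := by
  intro U hU
  convert hr _ (hU.preimage h𝒢.continuous_inv) using 1
  ext u
  constructor
  · rintro ⟨x, hx, rfl⟩
    refine ⟨𝒢.inv x, ?_, Subtype.ext (𝒢.r_inv x)⟩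
    rwa [Set.mem_preimage, 𝒢.inv_inv]
  · rintro ⟨x, hx, rfl⟩
    exact ⟨𝒢.inv x, hx, Subtype.ext (𝒢.s_inv x)⟩

end Gpd

/-- The base change of an open map along a continuous map is open. -/
theorem IsOpenMap.fst_fiberProduct {X Y Z : Type*} [TopologicalSpace X] [TopologicalSpace Y]
    [TopologicalSpace Z] {f : X → Z} {g : Y → Z} (hf : Continuous f) (hg : IsOpenMap g)
    {p : X × Y → Prop} (hp : ∀ x y, p (x, y) ↔ f x = g y) :
    IsOpenMap fun z : {z : X × Y // p z} => z.1.1 := by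
  intro O hO
  obtain ⟨V, hV, rfl⟩ := isOpen_induced_iff.1 hO
  refine isOpen_iff_mem_nhds.2 ?_
  rintro _ ⟨⟨⟨a, b⟩, hab⟩, ha, rfl⟩
  obtain ⟨U₁, U₂, hU₁, hU₂, ha₁, hb₂, hU⟩ := isOpen_prod_iff.1 hV _ _ ha
  refine mem_of_superset ((hU₁.inter ((hg U₂ hU₂).preimage hf)).mem_nhds
    ⟨ha₁, b, hb₂, ((hp a b).1 hab).symm⟩) ?_
  rintro x ⟨hx, y, hy, hxy⟩
  exact ⟨⟨(x, y), (hp x y).2 hxy.symm⟩, hU ⟨hx, hy⟩, rfl⟩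

/-! ### Free actions with continuous translation maps -/

namespace LeftAction

variable {G T : Type*} {𝒢 : Gpd G} {α : LeftAction 𝒢 T}

/-- The arrow `y⁻¹ x` fixes `t`, so it is a unit. This makes translation maps unique. -/
theorem IsFree.eq_of_act_eq (h : α.IsFree) {x y : G} {t : T} (hx : 𝒢.s x = α.ρ t)
    (hy : 𝒢.s y = α.ρ t) (e : α.act x t hx = α.act y t hy) : x = y := by
  have hr : 𝒢.r x = 𝒢.r y := by rw [← α.ρ_act x t hx, e, α.ρ_act]
  have hyx : 𝒢.s (𝒢.inv y) = 𝒢.r x := (𝒢.s_inv y).trans hr.symm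
  have hu : 𝒢.mul (𝒢.inv y) x hyx = α.ρ t := by
    refine h _ t ((𝒢.s_mul _ _ _).trans hx) ?_
    rw [α.mul_act _ _ _ hyx hx, α.act_congr rfl e _ ((𝒢.s_inv y).trans (α.ρ_act _ _ _).symm),
      α.inv_act_act]
  rw [← 𝒢.mul_inv_cancel hyx,
    𝒢.mul_congr rfl (hu.trans hy.symm) _ (𝒢.r_s y).symm, 𝒢.mul_s_unit]

/-- A free continuous action with continuous translation map is proper. -/
theorem IsFree.isProper [TopologicalSpace G] [TopologicalSpace T] [T2Space T] (h : α.IsFree)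
    (h𝒢 : 𝒢.IsLocallyCompact) (hα : α.IsContinuous) {R : T → T → Prop}
    (hR : IsClosed {z : T × T | R z.1 z.2}) (hR' : ∀ x t hx, R (α.act x t hx) t)
    {τ : ∀ t t', R t t' → G} (hτ : Continuous fun z : {z : T × T // R z.1 z.2} => τ z.1.1 z.1.2 z.2)
    (hτ' : ∀ t t' hR, ∃ h', α.act (τ t t' hR) t' h' = t) : α.IsProper := by
  have := h𝒢.t2
  intro C hC
  have hcl : IsClosed {z : G × T | 𝒢.s z.1 = α.ρ z.2} := isClosed_eq
    (h𝒢.continuous_s.comp continuous_fst) (hα.continuous_ρ.comp continuous_snd)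
  -- By freeness `x = τ (x · t) t`, so every pair `(x, t)` with `(x · t, t)` in `C` lies in the
  -- image of the compact set `C ∩ R` under `(t', t) ↦ (τ t' t, t)`. The preimage of `C` is then a
  -- closed subset of a compact set.
  have hC₁ := (hR.isClosedEmbedding_subtypeVal.isCompact_preimage hC).image
    (hτ.prodMk (continuous_snd.comp continuous_subtype_val))
  refine (hcl.isClosedEmbedding_subtypeVal.isCompact_preimage hC₁).of_isClosed_subset
    (hC.isClosed.preimage (hα.continuous_act.prodMk
      (continuous_snd.comp continuous_subtype_val))) ?_
  rintro ⟨⟨x, t⟩, hx⟩ hz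
  obtain ⟨h', e⟩ := hτ' _ _ (hR' x t hx)
  exact ⟨⟨(α.act x t hx, t), hR' x t hx⟩, hz, Prod.ext (h.eq_of_act_eq h' hx e) rfl⟩

end LeftAction

namespace RightAction

variable {G T : Type*} {𝒢 : Gpd G} {α : RightAction 𝒢 T}

theorem act_congr (α : RightAction 𝒢 T) {x x' : G} {t t' : T} (ht : t = t') (hx : x = x')
    (h : α.σ t = 𝒢.r x) (h' : α.σ t' = 𝒢.r x') : α.act t x h = α.act t' x' h' := by
  subst hx; subst ht; rfl

/-- Here it is `x y⁻¹` that fixes `t`. -/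
theorem IsFree.eq_of_act_eq (h : α.IsFree) {x y : G} {t : T} (hx : α.σ t = 𝒢.r x)
    (hy : α.σ t = 𝒢.r y) (e : α.act t x hx = α.act t y hy) : x = y := by
  have hs : 𝒢.s x = 𝒢.s y := by rw [← α.σ_act t x hx, e, α.σ_act]
  have hxy : 𝒢.s x = 𝒢.r (𝒢.inv y) := hs.trans (𝒢.r_inv y).symm
  have hu : 𝒢.mul x (𝒢.inv y) hxy = α.σ t := by
    refine h t _ (hx.trans (𝒢.r_mul _ _ _).symm) ?_
    rw [α.act_mul _ _ _ hx hxy, α.act_congr e rfl _ ((α.σ_act _ _ _).trans (𝒢.r_inv y).symm),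
      ← α.act_mul _ _ _ hy (𝒢.r_inv y).symm,
      α.act_congr rfl ((𝒢.mul_inv y).trans hy.symm) _ (α.σ_unit t).symm, α.act_unit]
  rw [← 𝒢.inv_inv x, 𝒢.inv_eq_of_mul hxy (hu.trans hx), 𝒢.inv_inv]

/-- A free continuous action with continuous translation map is proper. -/
theorem IsFree.isProper [TopologicalSpace G] [TopologicalSpace T] [T2Space T] (h : α.IsFree)
    (h𝒢 : 𝒢.IsLocallyCompact) (hα : α.IsContinuous) {R : T → T → Prop}
    (hR : IsClosed {z : T × T | R z.1 z.2}) (hR' : ∀ t x hx, R t (α.act t x hx))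
    {τ : ∀ t t', R t t' → G} (hτ : Continuous fun z : {z : T × T // R z.1 z.2} => τ z.1.1 z.1.2 z.2)
    (hτ' : ∀ t t' hR, ∃ h', α.act t (τ t t' hR) h' = t') : α.IsProper := by
  have := h𝒢.t2
  intro C hC
  have hcl : IsClosed {z : T × G | α.σ z.1 = 𝒢.r z.2} := isClosed_eq
    (hα.continuous_σ.comp continuous_fst) (h𝒢.continuous_r.comp continuous_snd)
  have hC₁ := (hR.isClosedEmbedding_subtypeVal.isCompact_preimage hC).image
    ((continuous_fst.comp continuous_subtype_val).prodMk hτ)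
  refine (hcl.isClosedEmbedding_subtypeVal.isCompact_preimage hC₁).of_isClosed_subset
    (hC.isClosed.preimage ((continuous_fst.comp continuous_subtype_val).prodMk
      hα.continuous_act)) ?_
  rintro ⟨⟨t, x⟩, hx⟩ hz
  obtain ⟨h', e⟩ := hτ' _ _ (hR' t x hx)
  exact ⟨⟨(t, α.act t x hx), hR' t x hx⟩, hz, Prod.ext rfl (h.eq_of_act_eq h' hx e)⟩

end RightAction

/-! ### The groupoid equivalence -/

theorem Gpd.mul_right_cancel {G : Type*} (𝒢 : Gpd G) {x y z : G} (h : 𝒢.s x = 𝒢.r z)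
    (h' : 𝒢.s y = 𝒢.r z) (e : 𝒢.mul x z h = 𝒢.mul y z h') : x = y := by
  have hz : 𝒢.s z = 𝒢.r (𝒢.inv z) := (𝒢.r_inv z).symm
  have key (w : G) (hw : 𝒢.s w = 𝒢.r z) :
      𝒢.mul (𝒢.mul w z hw) (𝒢.inv z) ((𝒢.s_mul _ _ _).trans hz) = w := by
    rw [𝒢.mul_assoc _ _ _ hw hz, 𝒢.mul_congr rfl (𝒢.mul_inv z) _ (hw.trans (𝒢.r_r z).symm)]
    exact 𝒢.mul_unit (𝒢.r_r z) _
  rw [← key x h, ← key y h']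
  exact 𝒢.mul_congr e rfl _ _

/-- The homeomorphism `(k, t) ↦ (k · t, k)`, with inverse `φ`, turns the action map into the first
projection of the fibre product of `ρ` and `r`, which is a base change of the open map `r`. -/
theorem LeftAction.isOpenMap_act {K T : Type*} {𝒦 : Gpd K} [TopologicalSpace K]
    [TopologicalSpace T] {α : LeftAction 𝒦 T} (h𝒦 : 𝒦.IsLocallyCompact) (hα : α.IsContinuous)
    (hr : IsOpenMap fun x => (⟨𝒦.r x, 𝒦.r_r x⟩ : 𝒦.Units)) :
    IsOpenMap fun z : α.Arrows => α.act z.1.1 z.1.2 z.2 := by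
  intro O hO
  let R := {z : T × K // α.ρ z.1 = 𝒦.r z.2}
  have hR (z : R) : 𝒦.s (𝒦.inv z.1.2) = α.ρ z.1.1 :=
    (𝒦.s_inv _).trans z.2.symm
  have h₁ : Continuous fun z : R => z.1.1 := continuous_fst.comp continuous_subtype_val
  have h₂ : Continuous fun z : R => z.1.2 := continuous_snd.comp continuous_subtype_val
  let φ : R → α.Arrows := fun z => ⟨(z.1.2, α.act (𝒦.inv z.1.2) z.1.1 (hR z)),
    (𝒦.r_inv _).symm.trans (α.ρ_act _ _ _).symm⟩
  have hφ : Continuous φ := (h₂.prodMk (hα.continuous_act.comp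
    (((h𝒦.continuous_inv.comp h₂).prodMk h₁).subtype_mk hR))).subtype_mk _
  have hρ : Continuous fun t => (⟨α.ρ t, α.ρ_unit t⟩ : 𝒦.Units) := hα.continuous_ρ.subtype_mk _
  convert IsOpenMap.fst_fiberProduct hρ hr
    (fun _ _ => ⟨fun h => Subtype.ext h, fun h => congrArg Subtype.val h⟩) _ (hO.preimage hφ) using 1
  ext t
  constructor
  · rintro ⟨z, hz, rfl⟩
    refine ⟨⟨(α.act z.1.1 z.1.2 z.2, z.1.1), α.ρ_act _ _ _⟩, ?_, rfl⟩
    have e : φ ⟨(α.act z.1.1 z.1.2 z.2, z.1.1), α.ρ_act _ _ _⟩ = z := by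
      ext
      · rfl
      · exact α.inv_act_act _
    rwa [Set.mem_preimage, e]
  · rintro ⟨z, hz, rfl⟩
    exact ⟨φ z, hz, α.act_inv_act _⟩

theorem LeftAction.isContinuous_rightOnArrows {K T : Type*} {𝒦 : Gpd K} [TopologicalSpace K]
    [TopologicalSpace T] {α : LeftAction 𝒦 T} (h𝒦 : 𝒦.IsLocallyCompact) (hα : α.IsContinuous) :
    α.rightOnArrows.IsContinuous := by
  have h₁ : Continuous fun z : α.Arrows => z.1.1 := continuous_fst.comp continuous_subtype_val
  have h₂ : Continuous fun z : α.Arrows => z.1.2 := continuous_snd.comp continuous_subtype_val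
  have v₁ := continuous_fst.comp (continuous_subtype_val
    (p := fun z : α.Arrows × K => α.rightOnArrows.σ z.1 = 𝒦.r z.2))
  have v₂ := continuous_snd.comp (continuous_subtype_val
    (p := fun z : α.Arrows × K => α.rightOnArrows.σ z.1 = 𝒦.r z.2))
  exact
  { continuous_σ := h𝒦.continuous_s.comp h₁
    continuous_act := ((h𝒦.continuous_mul.comp (((h₁.comp v₁).prodMk v₂).subtype_mk
      fun z => z.2)).prodMk (hα.continuous_act.comp (((h𝒦.continuous_inv.comp v₂).prodMk
        (h₂.comp v₁)).subtype_mk fun z => (𝒦.s_inv _).trans (z.2.symm.trans z.1.1.2)))).subtype_mk _ }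

theorem LeftAction.ByIsomorphisms.isContinuous_semidirectTranslation {G H : Type*} {𝒢 : Gpd G}
    {ℋ : Gpd H} [TopologicalSpace G] [TopologicalSpace H] {β : LeftAction 𝒢 H}
    (hβ : β.ByIsomorphisms ℋ) (hℋ : ℋ.IsLocallyCompact) (hc : β.IsContinuous) :
    hβ.semidirectTranslation.IsContinuous := by
  have h₁ : Continuous fun z : hβ.Arrows => z.1.1 := continuous_fst.comp continuous_subtype_val
  have h₂ : Continuous fun z : hβ.Arrows => z.1.2 := continuous_snd.comp continuous_subtype_val
  have v₁ := continuous_fst.comp (continuous_subtype_val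
    (p := fun z : hβ.Arrows × H => hβ.semidirect.s z.1 = hβ.semidirectTranslation.ρ z.2))
  have v₂ := continuous_snd.comp (continuous_subtype_val
    (p := fun z : hβ.Arrows × H => hβ.semidirect.s z.1 = hβ.semidirectTranslation.ρ z.2))
  exact
  { continuous_ρ := (hℋ.continuous_r.prodMk hc.continuous_ρ).subtype_mk _
    continuous_act := hℋ.continuous_mul.comp (((h₁.comp v₁).prodMk (hc.continuous_act.comp
      (((h₂.comp v₁).prodMk v₂).subtype_mk
        fun z => congrArg (fun a : hβ.Arrows => a.1.2) z.2))).subtype_mk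
          fun z => hβ.composable _ (congrArg (fun a : hβ.Arrows => a.1.1) z.2) _) }

/-! ### The groupoid equivalence for commuting actions -/

namespace LeftAction.Commuting

variable {G K T : Type*} {𝒢 : Gpd G} {𝒦 : Gpd K} {α : LeftAction 𝒦 T} {β : LeftAction 𝒢 T}
  (hc : α.Commuting β) {τ : (t t' : T) → α.ρ t = α.ρ t' → G}
  (hτ : ∀ t t' h, 𝒢.s (τ t t' h) = β.ρ t')

/-- With `z = (k, t)`, `w = (l, t')` and `x = τ t t'`, the arrow `x` moves `w` to `(l, t)`, and
multiplication by the factor over `k l⁻¹` gives `(k, t)`. -/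
theorem gpdEquiv_τl_act (hτ' : ∀ t t' h, β.act (τ t t' h) t' (hτ t t' h) = t)
    (z w : α.Arrows) (h : 𝒦.s z.1.1 = 𝒦.s w.1.1) :
    ∃ h', (hc.gpdEquiv τ hτ).left.act ((hc.gpdEquiv τ hτ).τl z w h) w h' = z := by
  have hx : α.ρ z.1.2 = α.ρ w.1.2 := z.2.symm.trans (h.trans w.2)
  have h' : hc.byIsomorphisms.semidirect.s ((hc.gpdEquiv τ hτ).τl z w h) =
      hc.byIsomorphisms.semidirectTranslation.ρ w := by
    ext
    · exact (𝒦.s_mul _ _ _).trans (𝒦.s_inv _)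
    · exact β.inv_act_act ((hτ _ _ hx).trans (hc.ρ_act' _ _ w.2).symm)
    · exact hτ _ _ hx
  refine ⟨h', ?_⟩
  ext
  · change 𝒦.mul (𝒦.mul z.1.1 (𝒦.inv w.1.1) _) w.1.1 _ = z.1.1
    rw [𝒦.mul_assoc _ _ _ (h.trans (𝒦.r_inv _).symm) (𝒦.s_inv _),
      𝒦.mul_congr rfl ((𝒦.inv_mul _).trans h.symm) _ (𝒦.r_s _).symm, 𝒦.mul_s_unit]
  · exact hτ' _ _ hx

/-- Equal left moments give `k · t = l · t'`. Hence `(k⁻¹ l)⁻¹ · t = l⁻¹ · (k · t) = t'`, while `k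
(k⁻¹ l) = l`. -/
theorem act_gpdEquiv_τr (z w : α.Arrows)
    (h : (hc.gpdEquiv τ hτ).left.ρ z = (hc.gpdEquiv τ hτ).left.ρ w) :
    ∃ h', (hc.gpdEquiv τ hτ).right.act z ((hc.gpdEquiv τ hτ).τr z w h) h' = w := by
  have h₁ : 𝒦.r z.1.1 = 𝒦.r w.1.1 :=
    congrArg (fun a : hc.byIsomorphisms.Arrows => a.1.1.1.1) h
  have h₂ : α.act z.1.1 z.1.2 z.2 = α.act w.1.1 w.1.2 w.2 :=
    congrArg (fun a : hc.byIsomorphisms.Arrows => a.1.1.1.2) h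
  have hi : 𝒦.s (𝒦.inv z.1.1) = 𝒦.r w.1.1 := (𝒦.s_inv _).trans h₁
  refine ⟨((𝒦.r_mul _ _ hi).trans (𝒦.r_inv _)).symm, ?_⟩
  ext
  · exact 𝒦.mul_inv_cancel hi
  · change α.act (𝒦.inv (𝒦.mul (𝒦.inv z.1.1) w.1.1 hi)) z.1.2 _ = w.1.2
    have hi' : 𝒦.s (𝒦.inv w.1.1) = 𝒦.r z.1.1 := (𝒦.s_inv _).trans h₁.symm
    have e : 𝒦.inv (𝒦.mul (𝒦.inv z.1.1) w.1.1 hi) = 𝒦.mul (𝒦.inv w.1.1) z.1.1 hi' := by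
      rw [𝒦.inv_of_mul]
      exact 𝒦.mul_congr rfl (𝒦.inv_inv _) _ _
    refine (α.act_congr e rfl _ ((𝒦.s_mul _ _ _).trans z.2)).trans ?_
    rw [α.mul_act _ _ _ hi' z.2,
      α.act_congr rfl h₂ _ ((𝒦.s_inv _).trans (α.ρ_act _ _ _).symm), α.inv_act_act]

variable [TopologicalSpace G] [TopologicalSpace K] [TopologicalSpace T]

/-- The continuous maps `τl` and `τr` carry most of the proof: they connect points with equal
moments, and with freeness they make both actions proper. Openness is a separate matter, settled by
`isOpenMap_act` on the left and by base change on the right. -/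
theorem isEquivalence_gpdEquiv [T2Space T] [LocallyCompactSpace T] [SecondCountableTopology T]
    (h𝒢 : 𝒢.IsLocallyCompact) (h𝒦 : 𝒦.IsLocallyCompact)
    (hr : IsOpenMap fun x => (⟨𝒦.r x, 𝒦.r_r x⟩ : 𝒦.Units)) (hα : α.IsContinuous)
    (hα' : IsOpenMap fun t => (⟨α.ρ t, α.ρ_unit t⟩ : 𝒦.Units))
    (hα'' : ∀ u : 𝒦.Units, ∃ t, α.ρ t = u) (hβ : β.IsContinuous) (hβ' : β.IsFree)
    (hτ' : ∀ t t' h, β.act (τ t t' h) t' (hτ t t' h) = t)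
    (hτc : Continuous fun z : {z : T × T // α.ρ z.1 = α.ρ z.2} => τ z.1.1 z.1.2 z.2) :
    (hc.gpdEquiv τ hτ).IsEquivalence := by
  have hA := isLocallyCompact_groupoid h𝒦 hα
  have hAβ := hc.isContinuous_onArrows hβ
  have hS := hc.byIsomorphisms.isLocallyCompact_semidirect h𝒢 hA hAβ
  have := hA.t2
  have := hS.t2
  have := h𝒦.t2
  have h₁ : Continuous fun z : α.Arrows => z.1.1 := continuous_fst.comp continuous_subtype_val
  have h₂ : Continuous fun z : α.Arrows => z.1.2 := continuous_snd.comp continuous_subtype_val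
  have left_continuous : (hc.gpdEquiv τ hτ).left.IsContinuous :=
    hc.byIsomorphisms.isContinuous_semidirectTranslation hA hAβ
  have right_continuous : (hc.gpdEquiv τ hτ).right.IsContinuous :=
    isContinuous_rightOnArrows h𝒦 hα
  have left_free : (hc.gpdEquiv τ hτ).left.IsFree := by
    intro x t h e
    have hk : 𝒦.mul x.1.1.1.1 t.1.1 _ = t.1.1 := congrArg (fun z : α.Arrows => z.1.1) e
    have hy : β.act x.1.2 t.1.2 _ = t.1.2 := congrArg (fun z : α.Arrows => z.1.2) e
    -- Cancellation in `𝒦` and freeness of `β` handle the two groupoid coordinates of `x`. Its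
    -- coordinate in `T` is forced by composability.
    have ht := congrArg (fun z : α.Arrows => z.1.2) (hc.byIsomorphisms.composable _
      (congrArg (fun a : hc.byIsomorphisms.Arrows => a.1.1) h)
      (congrArg (fun a : hc.byIsomorphisms.Arrows => a.1.2) h))
    ext
    · exact 𝒦.mul_right_cancel _ (𝒦.s_r _) (hk.trans (𝒦.r_unit_mul _).symm)
    · exact ht.trans (α.act_congr rfl hy _ t.2)
    · exact hβ' _ _ _ hy
  have right_free : (hc.gpdEquiv τ hτ).right.IsFree := by
    intro t x h e
    have e₁ : 𝒦.mul t.1.1 x h = t.1.1 := congrArg (fun z : α.Arrows => z.1.1) e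
    exact 𝒦.mul_left_cancel h (𝒦.r_s _).symm (e₁.trans (𝒦.mul_s_unit _).symm)
  have ρ_act (t y h) : (hc.gpdEquiv τ hτ).left.ρ ((hc.gpdEquiv τ hτ).right.act t y h) =
      (hc.gpdEquiv τ hτ).left.ρ t := by
    ext
    · exact 𝒦.r_mul _ _ _
    -- This is `(k y) · (y⁻¹ · t) = k · t`.
    · have hy : 𝒦.s (𝒦.inv y) = α.ρ t.1.2 := (𝒦.s_inv _).trans (h.symm.trans t.2)
      exact (α.mul_act _ _ _ h ((𝒦.r_inv y).symm.trans (α.ρ_act _ _ hy).symm)).trans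
        (α.act_congr rfl (α.act_inv_act hy) _ t.2)
    · exact hc.ρ_act' _ _ _
  have σ_act (x t h) : (hc.gpdEquiv τ hτ).right.σ ((hc.gpdEquiv τ hτ).left.act x t h) =
      (hc.gpdEquiv τ hτ).right.σ t := 𝒦.s_mul _ _ _
  have hτl : Continuous fun z : {z : α.Arrows × α.Arrows //
      (hc.gpdEquiv τ hτ).right.σ z.1 = (hc.gpdEquiv τ hτ).right.σ z.2} =>
      (hc.gpdEquiv τ hτ).τl z.1.1 z.1.2 z.2 := by
    have v₁ := continuous_fst.comp (continuous_subtype_val (p := fun z : α.Arrows × α.Arrows =>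
      (hc.gpdEquiv τ hτ).right.σ z.1 = (hc.gpdEquiv τ hτ).right.σ z.2))
    have v₂ := continuous_snd.comp (continuous_subtype_val (p := fun z : α.Arrows × α.Arrows =>
      (hc.gpdEquiv τ hτ).right.σ z.1 = (hc.gpdEquiv τ hτ).right.σ z.2))
    have ht := hτc.comp (((h₂.comp v₁).prodMk (h₂.comp v₂)).subtype_mk
      fun z => z.1.1.2.symm.trans (Eq.trans z.2 z.1.2.2))
    have hs (z : {z : α.Arrows × α.Arrows //
        (hc.gpdEquiv τ hτ).right.σ z.1 = (hc.gpdEquiv τ hτ).right.σ z.2}) :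
        𝒦.s z.1.1.1.1 = 𝒦.r (𝒦.inv z.1.2.1.1) := Eq.trans z.2 (𝒦.r_inv _).symm
    have hm := h𝒦.continuous_mul.comp (((h₁.comp v₁).prodMk
      (h𝒦.continuous_inv.comp (h₁.comp v₂))).subtype_mk hs)
    have ha := hβ.continuous_act.comp ((ht.prodMk (hα.continuous_act.comp v₂)).subtype_mk
      fun z => (hτ _ _ _).trans (hc.ρ_act' _ _ _).symm)
    exact (((hm.prodMk ha).subtype_mk _).prodMk ht).subtype_mk _
  have hτr : Continuous fun z : {z : α.Arrows × α.Arrows //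
      (hc.gpdEquiv τ hτ).left.ρ z.1 = (hc.gpdEquiv τ hτ).left.ρ z.2} =>
      (hc.gpdEquiv τ hτ).τr z.1.1 z.1.2 z.2 := by
    have v₁ := continuous_fst.comp (continuous_subtype_val (p := fun z : α.Arrows × α.Arrows =>
      (hc.gpdEquiv τ hτ).left.ρ z.1 = (hc.gpdEquiv τ hτ).left.ρ z.2))
    have v₂ := continuous_snd.comp (continuous_subtype_val (p := fun z : α.Arrows × α.Arrows =>
      (hc.gpdEquiv τ hτ).left.ρ z.1 = (hc.gpdEquiv τ hτ).left.ρ z.2))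
    exact h𝒦.continuous_mul.comp (((h𝒦.continuous_inv.comp (h₁.comp v₁)).prodMk
      (h₁.comp v₂)).subtype_mk fun z => (𝒦.s_inv _).trans
        (congrArg (fun a : hc.byIsomorphisms.Arrows => a.1.1.1.1) z.2))
  -- A unit of the semidirect product is determined by its point of `T`, its other coordinates being
  -- the moments of that point.
  have unit_ext (u : hc.byIsomorphisms.semidirect.Units) (t : α.Arrows)
      (e : α.act t.1.1 t.1.2 t.2 = u.1.1.1.1.2) : u.1 = (hc.gpdEquiv τ hτ).left.ρ t := by
    have e₁ : 𝒦.r u.1.1.1.1.1 = u.1.1.1.1.1 :=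
      congrArg (fun a : hc.byIsomorphisms.Arrows => a.1.1.1.1) u.2
    have e₂ : 𝒢.r u.1.1.2 = u.1.1.2 := congrArg (fun a : hc.byIsomorphisms.Arrows => a.1.2) u.2
    have e₃ : 𝒦.s u.1.1.1.1.1 = α.ρ u.1.1.1.1.2 := u.1.1.1.2
    have e₄ : β.ρ u.1.1.1.1.2 = 𝒢.r u.1.1.2 := u.1.2
    ext
    · change u.1.1.1.1.1 = 𝒦.r t.1.1
      rw [← α.ρ_act t.1.1 t.1.2 t.2, e, ← e₃, 𝒦.s_unit e₁]
    · exact e.symm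
    · change u.1.1.2 = β.ρ t.1.2
      rw [← hc.ρ_act' t.1.1 t.1.2 t.2, e, e₄, e₂]
  exact
  { t2 := inferInstance
    locallyCompact := hA.locallyCompact
    left_continuous := left_continuous
    left_free := left_free
    left_proper := left_free.isProper hS left_continuous
      (R := fun z w => (hc.gpdEquiv τ hτ).right.σ z = (hc.gpdEquiv τ hτ).right.σ w)
      (isClosed_eq (right_continuous.continuous_σ.comp continuous_fst)
        (right_continuous.continuous_σ.comp continuous_snd))
      σ_act hτl (hc.gpdEquiv_τl_act hτ hτ')
    right_continuous := right_continuous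
    right_free := right_free
    right_proper := right_free.isProper h𝒦 right_continuous
      (R := fun z w => (hc.gpdEquiv τ hτ).left.ρ z = (hc.gpdEquiv τ hτ).left.ρ w)
      (isClosed_eq (left_continuous.continuous_ρ.comp continuous_fst)
        (left_continuous.continuous_ρ.comp continuous_snd))
      (fun t x hx => (ρ_act t x hx).symm) hτr (hc.act_gpdEquiv_τr hτ)
    ρ_act := ρ_act
    σ_act := σ_act
    commute := by
      intro x t y h h'
      ext
      · exact 𝒦.mul_assoc _ _ _ _ _
      · exact hc.comm _ _ _ _ _
    ρ_open := by
      intro U hU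
      -- In terms of the point of `T`, the left moment map is the action map `(k, t) ↦ k · t`. The
      -- image of `U` is thus the preimage of an open subset of `T`.
      have hcont : Continuous fun z : hc.byIsomorphisms.semidirect.Units => z.1.1.1.1.2 :=
        h₂.comp (continuous_fst.comp (continuous_subtype_val.comp continuous_subtype_val))
      convert (isOpenMap_act h𝒦 hα hr U hU).preimage hcont using 1
      ext z
      constructor
      · rintro ⟨t, ht, rfl⟩
        exact ⟨t, ht, rfl⟩
      · rintro ⟨t, ht, e⟩
        exact ⟨t, ht, Subtype.ext (unit_ext z t e).symm⟩
    σ_open := by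
      have hs : Continuous fun k => (⟨𝒦.s k, 𝒦.r_s k⟩ : 𝒦.Units) :=
        h𝒦.continuous_s.subtype_mk _
      -- The right moment map is the open map `s` after `(k, t) ↦ k`, and the latter is the base
      -- change of the moment map of `α` along `s`.
      exact (h𝒦.isOpenMap_s hr).comp
        (IsOpenMap.fst_fiberProduct hs hα'
          fun _ _ => ⟨fun h => Subtype.ext h, fun h => congrArg Subtype.val h⟩)
    ρ_surj := fun u => ⟨⟨(α.ρ u.1.1.1.1.2, u.1.1.1.1.2), 𝒦.s_unit (α.ρ_unit _)⟩,
      (unit_ext u _ (α.unit_act _)).symm⟩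
    σ_surj := by
      intro u
      obtain ⟨t, ht⟩ := hα'' u
      exact ⟨⟨(u, t), (𝒦.s_unit u.2).trans ht.symm⟩, 𝒦.s_unit u.2⟩
    ρ_inj := fun t t' h => ⟨_, hc.act_gpdEquiv_τr hτ t t' h⟩
    -- The points are exchanged because `τl` carries its second argument to its first, whereas `τr`
    -- carries its first to its second.
    σ_inj := fun t t' h => ⟨_, hc.gpdEquiv_τl_act hτ hτ' t' t h.symm⟩
    τl_spec := hc.gpdEquiv_τl_act hτ hτ'
    τr_spec := hc.act_gpdEquiv_τr hτ }

end LeftAction.Commuting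

/-! ### The Fell bundle equivalence -/

namespace GpdEquiv.IsEquivalence

variable {G H T : Type*} {𝒢 : Gpd G} {ℋ : Gpd H} [TopologicalSpace G] [TopologicalSpace H]
  [TopologicalSpace T] {X : GpdEquiv 𝒢 ℋ T} (hX : X.IsEquivalence)
include hX

theorem s_τl (t t' : T) (h : X.right.σ t = X.right.σ t') : 𝒢.s (X.τl t t' h) = X.left.ρ t' :=
  (hX.τl_spec t t' h).1

theorem τl_act (t t' : T) (h : X.right.σ t = X.right.σ t') :
    X.left.act (X.τl t t' h) t' (hX.s_τl t t' h) = t :=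
  (hX.τl_spec t t' h).2

theorem r_τl (t t' : T) (h : X.right.σ t = X.right.σ t') : 𝒢.r (X.τl t t' h) = X.left.ρ t := by
  rw [← X.left.ρ_act _ _ (hX.s_τl t t' h), hX.τl_act]

theorem r_τr (t t' : T) (h : X.left.ρ t = X.left.ρ t') : X.right.σ t = ℋ.r (X.τr t t' h) :=
  (hX.τr_spec t t' h).1

theorem act_τr (t t' : T) (h : X.left.ρ t = X.left.ρ t') :
    X.right.act t (X.τr t t' h) (hX.r_τr t t' h) = t' :=
  (hX.τr_spec t t' h).2

/-- Freeness characterises `τl t t'` as the arrow carrying `t'` to `t`. The identities for `τl` at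
equal points, under inversion and under the left action follow by checking what the candidate arrow
does to a point. -/
theorem τl_eq_of_act_eq {x : G} {t t' : T} (hx : 𝒢.s x = X.left.ρ t')
    (e : X.left.act x t' hx = t) (h : X.right.σ t = X.right.σ t') : X.τl t t' h = x :=
  hX.left_free.eq_of_act_eq (hX.s_τl t t' h) hx ((hX.τl_act t t' h).trans e.symm)

theorem τl_self (t : T) : X.τl t t rfl = X.left.ρ t :=
  hX.τl_eq_of_act_eq (𝒢.s_unit (X.left.ρ_unit t)) (X.left.unit_act t) rfl

theorem inv_τl (t t' : T) (h : X.right.σ t = X.right.σ t') :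
    𝒢.inv (X.τl t t' h) = X.τl t' t h.symm := by
  have hi : 𝒢.s (𝒢.inv (X.τl t t' h)) = X.left.ρ t := (𝒢.s_inv _).trans (hX.r_τl t t' h)
  refine (hX.τl_eq_of_act_eq hi ?_ h.symm).symm
  refine (X.left.act_congr rfl (hX.τl_act t t' h).symm _
    ((𝒢.s_inv _).trans (X.left.ρ_act _ _ (hX.s_τl t t' h)).symm)).trans ?_
  exact X.left.inv_act_act _

theorem τl_act_left {x : G} {t : T} (t' : T) (hx : 𝒢.s x = X.left.ρ t)
    (h : X.right.σ t = X.right.σ t') :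
    X.τl (X.left.act x t hx) t' ((hX.σ_act x t hx).trans h) =
      𝒢.mul x (X.τl t t' h) (hx.trans (hX.r_τl t t' h).symm) := by
  refine hX.τl_eq_of_act_eq ((𝒢.s_mul _ _ _).trans (hX.s_τl t t' h)) ?_ _
  rw [X.left.mul_act _ _ _ _ (hX.s_τl t t' h)]
  exact X.left.act_congr rfl (hX.τl_act t t' h) _ _

/-- This is the base point identity under `⟪e, f⟫ g = e ⟪f, g⟫`. Write `t''` as `t' · τr t' t''`,
commute the two actions, and use that `τl t t'` carries `t'` to `t`. -/
theorem τl_act_eq_act_τr (t t' t'' : T) (h : X.right.σ t = X.right.σ t')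
    (h' : X.left.ρ t' = X.left.ρ t'') :
    X.left.act (X.τl t t' h) t'' ((hX.s_τl t t' h).trans h') =
      X.right.act t (X.τr t' t'' h') (h.trans (hX.r_τr t' t'' h')) := by
  have hr := hX.r_τr t' t'' h'
  have hl := hX.s_τl t t' h
  rw [X.left.act_congr rfl (hX.act_τr t' t'' h').symm _
    (hl.trans (hX.ρ_act _ _ hr).symm), ← hX.commute _ _ _ hl hr]
  exact X.right.act_congr (hX.τl_act t t' h) rfl _ _

end GpdEquiv.IsEquivalence

/-! ### The Fell bundle equivalence for commuting actions -/

namespace LeftAction.Commuting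

variable {G K T : Type*} {𝒢 : Gpd G} {𝒦 : Gpd K} {α : LeftAction 𝒦 T} {β : LeftAction 𝒢 T}
  (hc : α.Commuting β) {τ : (t t' : T) → α.ρ t = α.ρ t' → G}
  (hτ : ∀ t t' h, 𝒢.s (τ t t' h) = β.ρ t')
  [TopologicalSpace G] [TopologicalSpace K] [TopologicalSpace T]

/-- On fibres the laws are associativity, bilinearity and the involution laws of `B`. On base points
they are identities for the actions and translation maps of the groupoid equivalence `hX`. -/
theorem isEquivalence_fellEquiv [T2Space T] [LocallyCompactSpace T] [SecondCountableTopology T]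
    (h𝒢 : 𝒢.IsLocallyCompact) (h𝒦 : 𝒦.IsLocallyCompact) (hα : α.IsContinuous)
    (hβ : β.IsContinuous) (hX : (hc.gpdEquiv τ hτ).IsEquivalence)
    {B : FellBundle 𝒦} (hB : B.IsFell) : (hc.fellEquiv τ hτ B).IsEquivalence := by
  set A := (hc.onFellBundle B).semidirect hc.byIsomorphisms
  set E := α.fellBundle B
  set X := hc.gpdEquiv τ hτ
  have hA₀ := isLocallyCompact_groupoid h𝒦 hα
  have hAβ := hc.isContinuous_onArrows hβ
  have hS := hc.byIsomorphisms.isLocallyCompact_semidirect h𝒢 hA₀ hAβ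
  have hA : A.IsFell := hc.isFell_semidirect h𝒢 h𝒦 hα hβ hB
  have hE : E.IsFell := isFell_fellBundle h𝒦 hB hα
  have hEb := B.continuous_base_pullback fun z : α.Arrows => z.1.1
  have hEP := B.continuous_ofPullback fun z : α.Arrows => z.1.1
  have hAb := E.continuous_base_pullback fun z : hc.byIsomorphisms.Arrows => z.1.1
  have hAP := hEP.comp (E.continuous_ofPullback fun z : hc.byIsomorphisms.Arrows => z.1.1)
  have extA {z w : hc.byIsomorphisms.Arrows} (h : z = w) {a : B.Fib z.1.1.1.1}
      {b : B.Fib w.1.1.1.1} (e : (⟨z.1.1.1.1, a⟩ : Tot B.Fib) = ⟨w.1.1.1.1, b⟩) :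
      (⟨z, a⟩ : Tot A.Fib) = ⟨w, b⟩ :=
    Tot.pullback_ext (F := B.Fib) (fun z : hc.byIsomorphisms.Arrows => z.1.1.1.1) h e
  have extE {z w : α.Arrows} (h : z = w) {a : B.Fib z.1.1}
      {b : B.Fib w.1.1} (e : (⟨z.1.1, a⟩ : Tot B.Fib) = ⟨w.1.1, b⟩) :
      (⟨z, a⟩ : Tot E.Fib) = ⟨w, b⟩ :=
    Tot.pullback_ext (F := B.Fib) (fun z : α.Arrows => z.1.1) h e
  -- These three facts extract composability in `𝒦` for the left action, the left inner product and
  -- the right inner product.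
  have cl {x : hc.byIsomorphisms.Arrows} {t : α.Arrows}
      (h : hc.byIsomorphisms.semidirect.s x = X.left.ρ t) : 𝒦.s x.1.1.1.1 = 𝒦.r t.1.1 :=
    congrArg (fun z : hc.byIsomorphisms.Arrows => z.1.1.1.1) h
  have cr {t t' : α.Arrows} (h : X.right.σ t = X.right.σ t') :
      𝒦.s t.1.1 = 𝒦.r (𝒦.inv t'.1.1) := Eq.trans h (𝒦.r_inv _).symm
  have ci {t t' : α.Arrows} (h : X.left.ρ t = X.left.ρ t') :
      𝒦.s (𝒦.inv t.1.1) = 𝒦.r t'.1.1 := (𝒦.s_inv _).trans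
    (congrArg (fun z : hc.byIsomorphisms.Arrows => z.1.1.1.1) h)
  have smul_star {x y : K} (h : 𝒦.s x = 𝒦.r (𝒦.inv y)) (z : ℂ) (e : B.Fib x) (f : B.Fib y) :
      B.mul h e (B.star (z • f)) = (starRingEnd ℂ z) • B.mul h e (B.star f) := by
    rw [hB.star_smul, hB.mul_smul]
  have star_smul {x y : K} (h : 𝒦.s (𝒦.inv x) = 𝒦.r y) (z : ℂ) (e : B.Fib x) (f : B.Fib y) :
      B.mul h (B.star (z • e)) f = (starRingEnd ℂ z) • B.mul h (B.star e) f := by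
    rw [hB.star_smul, hB.smul_mul]
  have mul_star_add {x y : K} (h : 𝒦.s x = 𝒦.r (𝒦.inv y)) (e : B.Fib x) (f g : B.Fib y) :
      B.mul h e (B.star (f + g)) = B.mul h e (B.star f) + B.mul h e (B.star g) := by
    rw [hB.star_add, hB.mul_add]
  have star_add_mul {x y : K} (h : 𝒦.s (𝒦.inv x) = 𝒦.r y) (e f : B.Fib x) (g : B.Fib y) :
      B.mul h (B.star (e + f)) g = B.mul h (B.star e) g + B.mul h (B.star f) g := by
    rw [hB.star_add, hB.add_mul]
  exact
  { left_groupoid := hS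
    right_groupoid := h𝒦
    groupoid_equivalence := hX
    left_fell := hA
    right_fell := hB
    banach := hE.banach
    continuous_lact := by
      have v₁ := continuous_fst.comp (continuous_subtype_val (p := fun z : Tot A.Fib × Tot E.Fib =>
        hc.byIsomorphisms.semidirect.s z.1.base = X.left.ρ z.2.base))
      have v₂ := continuous_snd.comp (continuous_subtype_val (p := fun z : Tot A.Fib × Tot E.Fib =>
        hc.byIsomorphisms.semidirect.s z.1.base = X.left.ρ z.2.base))
      exact (B.continuous_pullback_iff _).2
        ⟨hB.continuous_mul.comp (((hAP.comp v₁).prodMk (hEP.comp v₂)).subtype_mk fun z => cl z.2),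
        hX.left_continuous.continuous_act.comp
          (((hAb.comp v₁).prodMk (hEb.comp v₂)).subtype_mk fun z => z.2)⟩
    lact_add_left := fun h a b e => hB.add_mul (cl h) a b e
    lact_add_right := fun h a e f => hB.mul_add (cl h) a e f
    lact_smul_left := fun h z a e => hB.smul_mul (cl h) z a e
    lact_smul_right := fun h z a e => hB.mul_smul (cl h) z a e
    lact_mul := fun h h' a b e => extE (X.left.mul_act _ _ _ h h') (hB.mul_assoc
      (congrArg (fun z : hc.byIsomorphisms.Arrows => z.1.1.1.1) h) (cl h') a b e)
    norm_lact_le := fun h a e => hB.norm_mul_le (cl h) a e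
    continuous_ract := by
      have v₁ := continuous_fst.comp (continuous_subtype_val (p := fun z : Tot E.Fib × Tot B.Fib =>
        X.right.σ z.1.base = 𝒦.r z.2.base))
      have v₂ := continuous_snd.comp (continuous_subtype_val (p := fun z : Tot E.Fib × Tot B.Fib =>
        X.right.σ z.1.base = 𝒦.r z.2.base))
      exact (B.continuous_pullback_iff _).2
        ⟨hB.continuous_mul.comp (((hEP.comp v₁).prodMk v₂).subtype_mk fun z => z.2),
        hX.right_continuous.continuous_act.comp
          (((hEb.comp v₁).prodMk (hB.banach.continuous_proj.comp v₂)).subtype_mk fun z => z.2)⟩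
    ract_add_left := fun h a b e => hB.add_mul h a b e
    ract_add_right := fun h a e f => hB.mul_add h a e f
    ract_smul_left := fun h z a e => hB.smul_mul h z a e
    ract_smul_right := fun h z a e => hB.mul_smul h z a e
    ract_mul := fun h h' e b c => extE (X.right.act_mul _ _ _ h h')
      (hB.mul_assoc h h' e b c).symm
    norm_ract_le := fun h e b => hB.norm_mul_le h e b
    commute := fun h h' a e b => extE (hX.commute _ _ _ h h') (hB.mul_assoc (cl h) h' a e b)
    lip_add_left := fun h e f g => hB.add_mul (cr h) e f (B.star g)
    lip_smul_left := fun h z e f => hB.smul_mul (cr h) z e (B.star f)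
    lip_add_right := fun h e f g => mul_star_add (cr h) e f g
    lip_smul_right := fun h z e f => smul_star (cr h) z e f
    rip_add_left := fun h e f g => star_add_mul (ci h) e f g
    rip_smul_left := fun h z e f => star_smul (ci h) z e f
    rip_add_right := fun h e f g => hB.mul_add (ci h) (B.star e) f g
    rip_smul_right := fun h z e f => hB.mul_smul (ci h) z (B.star e) f
    lip_star := by
      intro t t' h e f
      exact extA (hX.inv_τl t t' h) ((hB.star_mul (cr h) e (B.star f)).trans
        (B.tot_mul_congr (hB.star_star f) rfl _ (cr h.symm)))
    -- The right inner product takes values in `B` itself, so the equation in `B` already contains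
    -- the base point identity.
    rip_star := fun h e f => (hB.star_mul (ci h) (B.star e) f).trans
      (B.tot_mul_congr rfl (hB.star_star e) _ (ci h.symm))
    lip_lact := by
      intro x t t' hx h
      exact ⟨hx.trans (hX.r_τl t t' h).symm, fun a e f => extA (hX.τl_act_left t' hx h)
        (hB.mul_assoc (cl hx) (cr h) a e (B.star f))⟩
    rip_ract := by
      intro t t' y h hy
      refine ⟨(𝒦.s_mul _ _ _).trans hy, fun e f b => ?_⟩
      exact (hB.mul_assoc (ci h) hy (B.star e) f b).symm
    lip_act := by
      intro t t' t'' h h'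
      exact ⟨(hX.s_τl t t' h).trans h', h.trans (hX.r_τr t' t'' h'), fun e f g =>
        extE (hX.τl_act_eq_act_τr t t' t'' h h') (hB.mul_assoc (cr h) (ci h') e (B.star f) g)⟩
    imprimitivity := by
      intro t
      -- Over `(k, t)` the translation maps give the unit at `k · t` and `k⁻¹ k = s k`. After the
      -- transports are rewritten in `B`, the requirement is the imprimitivity axiom of `B` at `k`.
      refine ⟨hX.τl_self t, 𝒦.inv_mul t.1.1, ?_⟩
      have hm (u : hc.byIsomorphisms.Arrows) (hu : hc.byIsomorphisms.semidirect.r u = u) :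
          A.unitMul hu =
            B.unitMul (congrArg (fun z : hc.byIsomorphisms.Arrows => z.1.1.1.1) hu) := by
        funext a b
        exact hc.semidirect_cast _ _
      have hs (u : hc.byIsomorphisms.Arrows) (hu : hc.byIsomorphisms.semidirect.r u = u) :
          A.unitStar hu =
            B.unitStar (congrArg (fun z : hc.byIsomorphisms.Arrows => z.1.1.1.1) hu) := by
        funext a
        exact hc.semidirect_cast _ _
      rw [hm, hs]
      simp only [hc.semidirect_cast, fellBundle_cast]
      exact hB.imprimitivity t.1.1 }

end LeftAction.Commuting

/-! ### The two translations of a groupoid, and the theorem -/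

namespace Gpd

variable {G : Type*} {𝒢 : Gpd G} [TopologicalSpace G]

theorem IsLocallyCompact.isContinuous_leftTranslation (h𝒢 : 𝒢.IsLocallyCompact) :
    𝒢.leftTranslation.IsContinuous where
  continuous_ρ := h𝒢.continuous_r
  continuous_act := h𝒢.continuous_mul

theorem IsLocallyCompact.isContinuous_inverseTranslation (h𝒢 : 𝒢.IsLocallyCompact) :
    𝒢.inverseTranslation.IsContinuous where
  continuous_ρ := h𝒢.continuous_s
  continuous_act := h𝒢.continuous_mul.comp (((continuous_snd.comp continuous_subtype_val).prodMk
    (h𝒢.continuous_inv.comp (continuous_fst.comp continuous_subtype_val))).subtype_mk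
      fun z => z.2.symm.trans (𝒢.r_inv _).symm)

omit [TopologicalSpace G] in
-- Cancelling `y` in `y x⁻¹ = y` shows that `x⁻¹` is a unit.
theorem isFree_inverseTranslation (𝒢 : Gpd G) : 𝒢.inverseTranslation.IsFree := by
  intro x y h e
  have h' : 𝒢.s y = 𝒢.r (𝒢.inv x) := h.symm.trans (𝒢.r_inv x).symm
  have hx : 𝒢.inv x = 𝒢.s y :=
    𝒢.mul_left_cancel h' (𝒢.r_s y).symm (e.trans (𝒢.mul_s_unit y).symm)
  rw [← 𝒢.inv_inv x, hx]
  exact 𝒢.inv_unit (𝒢.r_s y)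

omit [TopologicalSpace G] in
-- This is `t' (t⁻¹ t')⁻¹ = t' (t'⁻¹ t) = t`.
theorem inverseTranslation_translation (𝒢 : Gpd G) (t t' : G) (h : 𝒢.r t = 𝒢.r t') :
    𝒢.inverseTranslation.act (𝒢.translation t t' h) t' (𝒢.s_translation t t' h) = t := by
  have h₁ : 𝒢.s (𝒢.inv t) = 𝒢.r t' := (𝒢.s_inv t).trans h
  have h₂ : 𝒢.s (𝒢.inv t') = 𝒢.r t := (𝒢.s_inv t').trans h.symm
  have e : 𝒢.inv (𝒢.translation t t' h) = 𝒢.mul (𝒢.inv t') t h₂ :=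
    (𝒢.inv_of_mul h₁).trans (𝒢.mul_congr rfl (𝒢.inv_inv t) _ _)
  exact (𝒢.mul_congr rfl e _ _).trans (𝒢.mul_inv_cancel h₂)

theorem IsLocallyCompact.continuous_translation (h𝒢 : 𝒢.IsLocallyCompact) :
    Continuous fun z : {z : G × G // 𝒢.r z.1 = 𝒢.r z.2} => 𝒢.translation z.1.1 z.1.2 z.2 :=
  h𝒢.continuous_mul.comp (((h𝒢.continuous_inv.comp
    (continuous_fst.comp continuous_subtype_val)).prodMk
      (continuous_snd.comp continuous_subtype_val)).subtype_mk fun z => (𝒢.s_inv _).trans z.2)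

end Gpd

theorem mainTheorem3 {G : Type*} [TopologicalSpace G] [MeasurableSpace G] [BorelSpace G]
    (𝒢 : Gpd G) (h𝒢 : 𝒢.IsLocallyCompact) (haar : 𝒢.HaarSystem)
    (B : FellBundle 𝒢) (hB : B.IsFell) :
    𝒢.leftTranslation.groupoid.IsLocallyCompact ∧
    (𝒢.leftTranslation.fellBundle B).IsFell ∧
    (𝒢.translations_commute.onFellBundle B).IsByIsomorphisms ∧
    (𝒢.translations_commute.fellEquiv 𝒢.translation 𝒢.s_translation B).IsEquivalence := by
  have := h𝒢.t2
  have := h𝒢.locallyCompact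
  have := h𝒢.secondCountable
  have hα := h𝒢.isContinuous_leftTranslation
  have hβ := h𝒢.isContinuous_inverseTranslation
  -- Openness of `r` serves twice below: as openness of the range map of the acting groupoid, and as
  -- openness of the moment map of left translation.
  have hr := haar.isOpenMap_r h𝒢
  exact ⟨LeftAction.isLocallyCompact_groupoid h𝒢 hα, LeftAction.isFell_fellBundle h𝒢 hB hα,
    𝒢.translations_commute.isByIsomorphisms_onFellBundle hβ,
    𝒢.translations_commute.isEquivalence_fellEquiv 𝒢.s_translation h𝒢 h𝒢 hα hβ
      (𝒢.translations_commute.isEquivalence_gpdEquiv 𝒢.s_translation h𝒢 h𝒢 hr hα hr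
        (fun u => ⟨u, u.2⟩) hβ 𝒢.isFree_inverseTranslation 𝒢.inverseTranslation_translation
        h𝒢.continuous_translation) hB⟩
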